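/- **Model.** A model instance consists of positive integers $m,n,K$ with $K\le\min\{m,n\}$, numbers $p_{ij}\in[0,1]$ for $1\le i<j\le\max\{m,n\}$, and numbers $\varrho_{ij}\in[0,1]$ for $1\le i<j\le K$. Correlated Bernoulli random graphs $(G,H)$ with these parameters are random simple graphs $G$ on $[m]=\{1,\dots,m\}$ and $H$ on $[n]=\{1,\dots,n\}$ such that $\mathbb P(i\sim_G j)=p_{ij}$ for $1\le i<j\le m$; $\mathbb P(i\sim_H j)=p_{ij}$ for $1\le i<j\le n$; for $1\le i<j\le K$ the indicators of $i\sim_G j$ and $i\sim_H j$ have Pearson correlation coefficient $\varrho_{ij}$; and, apart from these correlations, all adjacencies are collectively independent (that is, the pairs $(\mathbf 1_{i\sim_G j},\mathbf 1_{i\sim_H j})$, $1\le i<j\le K$, together with the remaining single indicators $\mathbf 1_{i\sim_G j}$ ($i<j\le m$, $j>K$) and $\mathbf 1_{i\sim_H j}$ ($i<j\le n$, $j>K$), form a mutually independent family). Let $A\in\{0,\pm1\}^{m\times m}$ be the $\pm1$-adjacency matrix of $G$: $A_{ii}=0$ and, for $i\ne j$, $A_{ij}=1$ if $i\sim_G j$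 and $A_{ij}=-1$ otherwise; let $B\in\{0,\pm1\}^{n\times n}$ be the corresponding matrix of $H$. Let $\Pi_{m,n,K}$ be the set of $m\times n$ matrices with entries in $\{0,1\}$, all row sums and all column sums at most $1$, and entries summing to $K$. **Assumptions.** For every $\mathfrak n=1,2,3,\dots$ a model instance with $\max\{m,n\}=\mathfrak n$ is given (so $m,n,K,p_{ij},\varrho_{ij}$ all depend on $\mathfrak n$), with correlated Bernoulli random graphs $(G,H)$ having these parameters; the pairs $(G,H)$ for all $\mathfrak n$ are defined on one common probability space, with no assumption on their dependence for different $\mathfrak n$. There is a real number $q\in(0,\tfrac12)$, not depending on $\mathfrak n$, such that for every $\mathfrak n$ one has $p_{ij}\in[q,1-q]$ for all $1\le i<j\le\mathfrak n$ and $\varrho_{ij}>(1-2q)^2$ for all $1\le i<j\le K$. Finally, with $\epsilon=\epsilon(\mathfrak n):=\min_{1\le i<j\le K}\bigl(\varrho_{ij}-(1-2q)^2\bigr)$ (and $\epsilon:=0$ if $K=1$), $$\lim_{\mathfrak n\to\infty}\frac{\epsilon^2K}{\log\mathfrak n}=\infty .$$ **Lemma.** Under these assumptions, with probability $1$, for all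 but finitely many $\mathfrak n$ the bilinear form $\operatorname{trace}(APBQ^{T})$ over pairs $(P,Q)\in\Pi_{m,n,K}\times\Pi_{m,n,K}$ has exactly one maximizer, namely $P=Q=\begin{bmatrix}I_K&0\\0&0\end{bmatrix}$ (of size $m\times n$): $$\operatorname*{arg\,max}_{P,Q\in\Pi_{m,n,K}}\operatorname{trace}(APBQ^{T})=\left\{\left(\begin{bmatrix}I_K&0\\0&0\end{bmatrix},\begin{bmatrix}I_K&0\\0&0\end{bmatrix}\right)\right\}.$$ -/

import Mathlib

open MeasureTheory ProbabilityTheory Filter Topology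

noncomputable section

/-- `matchingMatrices c d e` is the set `Π_{c,d,e}` of `c × d` matrices with entries in `{0,1}`, all
row sums and all column sums at most `1`, and entries summing to `e`. -/
def matchingMatrices (c d e : ℕ) : Set (Matrix (Fin c) (Fin d) ℝ) :=
  {X | (∀ i j, X i j = 0 ∨ X i j = 1) ∧ (∀ i, ∑ j, X i j ≤ 1) ∧ (∀ j, ∑ i, X i j ≤ 1) ∧
    ∑ i, ∑ j, X i j = (e : ℝ)}

/-- The `c × d` block matrix `[[I_K, 0], [0, 0]]`. -/
def coreMatrix (c d K : ℕ) : Matrix (Fin c) (Fin d) ℝ :=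
  Matrix.of fun i j => if (i : ℕ) = (j : ℕ) ∧ (i : ℕ) < K then 1 else 0

open Classical in
/-- The `±1`-adjacency matrix of a graph, with the convention that the diagonal is zero. -/
def signedAdjMatrix {V : Type*} (G : SimpleGraph V) : Matrix V V ℝ :=
  Matrix.of fun i j => if i = j then 0 else if G.Adj i j then 1 else -1

/-- The set of all maximizers of `f` over `s`. -/
def argMaxOn {α : Type*} (f : α → ℝ) (s : Set α) : Set α :=
  {x | x ∈ s ∧ ∀ y ∈ s, f y ≤ f x}

/-- The Pearson correlation coefficient of two real random variables. -/
def pearsonCorr {Ω : Type*} [MeasurableSpace Ω] (X Y : Ω → ℝ) (μ : Measure Ω) : ℝ :=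
  covariance X Y μ / (√(variance X μ) * √(variance Y μ))

/-- The parameters of the correlated Bernoulli random graph model. Vertices are numbered from `0`;
only the values `p i j` with `i < j < max m n` and `rho i j` with `i < j < K` are relevant. -/
structure ModelParams where
  /-- number of vertices of the first graph -/
  m : ℕ
  /-- number of vertices of the second graph -/
  n : ℕ
  /-- size of the core -/
  K : ℕ
  /-- edge probabilities -/
  p : ℕ → ℕ → ℝ
  /-- edge correlations in the core -/
  rho : ℕ → ℕ → ℝ
  K_pos : 0 < K
  K_le_m : K ≤ m
  K_le_n : K ≤ n
  p_mem : ∀ i j, i < j → j < max m n → p i j ∈ Set.Icc (0 : ℝ) 1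
  rho_mem : ∀ i j, i < j → j < K → rho i j ∈ Set.Icc (0 : ℝ) 1

/-- The number `ε = min_{i < j < K} (ρ_{ij} - (1 - 2 q)²)`. It is a minimum over a finite set, which is
nonempty when `K ≥ 2`; for `K = 1` the value is `0`. -/
def ModelParams.eps (M : ModelParams) (q : ℝ) : ℝ :=
  sInf {x : ℝ | ∃ i j : ℕ, i < j ∧ j < M.K ∧ x = M.rho i j - (1 - 2 * q) ^ 2}

/-- The indicator random variable of adjacency of `i` and `j` in the random graph `G`. -/
def adjInd {Ω V : Type*} (G : Ω → SimpleGraph V) (i j : V) : Ω → ℝ :=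
  Set.indicator {ω | (G ω).Adj i j} fun _ => 1

/-- Index set of the collectively independent groups of adjacencies: the core pairs
`i < j < K`, the remaining pairs of the first graph, the remaining pairs of the second graph. -/
abbrev AdjBlock (m n K : ℕ) : Type :=
  {e : Fin K × Fin K // e.1 < e.2} ⊕
    ({e : Fin m × Fin m // e.1 < e.2 ∧ K ≤ (e.2 : ℕ)} ⊕
      {e : Fin n × Fin n // e.1 < e.2 ∧ K ≤ (e.2 : ℕ)})

/-- The random variable of a group: for a core pair, the two adjacency indicators (in `G` and in `H`)
jointly; for any other pair of `G` or of `H`, the single adjacency indicator (the other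
coordinate is the constant `0`). -/
def adjBlockVar {Ω : Type*} {m n K : ℕ} (hm : K ≤ m) (hn : K ≤ n)
    (G : Ω → SimpleGraph (Fin m)) (H : Ω → SimpleGraph (Fin n)) :
    AdjBlock m n K → Ω → ℝ × ℝ
  | .inl e => fun ω =>
      (adjInd G (Fin.castLE hm e.1.1) (Fin.castLE hm e.1.2) ω,
        adjInd H (Fin.castLE hn e.1.1) (Fin.castLE hn e.1.2) ω)
  | .inr (.inl e) => fun ω => (adjInd G e.1.1 e.1.2 ω, 0)
  | .inr (.inr e) => fun ω => (0, adjInd H e.1.1 e.1.2 ω)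

/-- `(G, H)` are correlated Bernoulli random graphs with the given parameters. -/
structure IsCorrelatedBernoulli {Ω : Type*} [MeasurableSpace Ω] (μ : Measure Ω) (M : ModelParams)
    (G : Ω → SimpleGraph (Fin M.m)) (H : Ω → SimpleGraph (Fin M.n)) : Prop where
  measurable_G : Measurable G
  measurable_H : Measurable H
  prob_G : ∀ i j : Fin M.m, i < j → μ.real {ω | (G ω).Adj i j} = M.p i j
  prob_H : ∀ i j : Fin M.n, i < j → μ.real {ω | (H ω).Adj i j} = M.p i j
  corr : ∀ i j : Fin M.K, i < j →
    pearsonCorr (adjInd G (Fin.castLE M.K_le_m i) (Fin.castLE M.K_le_m j))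
      (adjInd H (Fin.castLE M.K_le_n i) (Fin.castLE M.K_le_n j)) μ = M.rho i j
  indep : iIndepFun (adjBlockVar M.K_le_m M.K_le_n G H) μ

end

/-! Encode matchings as sets of pairs `S` and `T`. Then `trace (A P B Qᵀ)` is the sum over `S × T`
of products of a sign of `A` and a sign of `B`. Let `D` be the core matching and `N` the number of
summands of `D × D` which are missing from `S × T`.

*Mean.* A core summand off the diagonal has mean at least its correlation, hence at least
`(1 - 2q)² + ε`. Any other summand either multiplies independent signs, and has mean at most
`(1 - 2q)²`, or has its two pairs crossing inside the core. With `d = #(D \ S) + #(D \ T)` there are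
`O(d)` crossing summands and missing diagonal ones, so the expected advantage of `(D, D)` over
`(S, T)` is at least `εN - 2d`. Since `N ≥ Kd / 2`, this is at least `εN / 2` once `εK ≥ 8`.

*Tail.* Each summand involves at most two independent blocks and each block influences at most
eight of the differing summands, so McDiarmid's inequality gives a deviation probability of at most
`exp (-ε²N / 256)`, hence at most `y ^ (2d)` with `y = exp (-ε²K / 1024)`.

*Union bound.* The symmetric differences of `D` with `S` and with `T` have `2d` elements in total,
and dropping the matching condition on `S` and `T` makes the sum of `y ^ (2d)` over all pairs but
`(D, D)` the binomial expression `(1 + y) ^ (2mn) - 1`. This is of order `𝔫⁻²` as soon as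
`ε²K ≥ 4096 log 𝔫`, and the Borel–Cantelli lemma applies.
-/

open scoped Finset NNReal

section BoundedDifferences

variable {ι : Type*} [DecidableEq ι] {S : ι → Type*}

/-- `F` has bounded differences `c`: changing the coordinate `i` alone changes its value by at most
`c i`. This is the hypothesis of McDiarmid's inequality. -/
def HasBoundedDifferences (F : (∀ i, S i) → ℝ) (c : ι → ℝ≥0) : Prop :=
  ∀ x i s, |F (Function.update x i s) - F x| ≤ c i

end BoundedDifferences

section McDiarmid

theorem hasSubgaussianMGF_prod_add {α β : Type*} [MeasurableSpace α] [MeasurableSpace β]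
    {μ : Measure α} {ν : Measure β} [SFinite μ] [SFinite ν] {X : α → ℝ} {Y : α × β → ℝ}
    {cX cY : ℝ≥0} (hY_meas : Measurable Y) (hX : HasSubgaussianMGF X cX μ)
    (hY : ∀ a, HasSubgaussianMGF (fun b => Y (a, b)) cY ν) :
    HasSubgaussianMGF (fun z => X z.1 + Y z) (cX + cY) (μ.prod ν) := by
  have hsplit : ∀ t a b,
      Real.exp (t * (X a + Y (a, b))) = Real.exp (t * X a) * Real.exp (t * Y (a, b)) :=
    fun t a b => by rw [mul_add, Real.exp_add]
  have hinner : ∀ t a, ∫ b, Real.exp (t * (X a + Y (a, b))) ∂ν ≤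
      Real.exp (t * X a) * Real.exp (cY * t ^ 2 / 2) := fun t a => by
    simp_rw [hsplit, integral_const_mul]
    exact mul_le_mul_of_nonneg_left ((hY a).mgf_le t) (Real.exp_nonneg _)
  have hint : ∀ t, Integrable (fun z : α × β => Real.exp (t * (X z.1 + Y z))) (μ.prod ν) := by
    intro t
    have hmeas : AEStronglyMeasurable (fun z : α × β => Real.exp (t * (X z.1 + Y z)))
        (μ.prod ν) := by
      have := hX.aemeasurable.comp_fst (ν := ν)
      exact (Real.measurable_exp.comp_aemeasurable
        ((this.add hY_meas.aemeasurable).const_mul t)).aestronglyMeasurable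
    refine (integrable_prod_iff hmeas).2 ⟨ae_of_all _ fun a => ?_, ?_⟩
    · simp_rw [hsplit]
      exact ((hY a).integrable_exp_mul t).const_mul _
    · refine ((hX.integrable_exp_mul t).mul_const (Real.exp (cY * t ^ 2 / 2))).mono'
        hmeas.norm.integral_prod_right' (ae_of_all _ fun a => ?_)
      simp_rw [Real.norm_eq_abs, Real.abs_exp]
      rw [abs_of_nonneg (integral_nonneg fun b => Real.exp_nonneg _)]
      exact hinner t a
  refine ⟨hint, fun t => ?_⟩
  calc mgf (fun z => X z.1 + Y z) (μ.prod ν) t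
    _ = ∫ a, ∫ b, Real.exp (t * (X a + Y (a, b))) ∂ν ∂μ := integral_prod _ (hint t)
    _ ≤ ∫ a, Real.exp (t * X a) * Real.exp (cY * t ^ 2 / 2) ∂μ :=
        integral_mono (hint t).integral_prod_left ((hX.integrable_exp_mul t).mul_const _) (hinner t)
    _ ≤ Real.exp (cX * t ^ 2 / 2) * Real.exp (cY * t ^ 2 / 2) := by
        rw [integral_mul_const]
        exact mul_le_mul_of_nonneg_right (hX.mgf_le t) (Real.exp_nonneg _)
    _ = Real.exp ((cX + cY : ℝ≥0) * t ^ 2 / 2) := by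
        rw [← Real.exp_add, NNReal.coe_add]
        ring_nf

theorem hasSubgaussianMGF_sub_integral_of_abs_sub_le {α : Type*} [MeasurableSpace α]
    {μ : Measure α} [IsProbabilityMeasure μ] {f : α → ℝ} {c : ℝ≥0} (hf : Measurable f)
    (hc : ∀ x y, |f x - f y| ≤ c) :
    HasSubgaussianMGF (fun x => f x - ∫ y, f y ∂μ) ((c / 2) ^ 2) μ := by
  obtain ⟨x₀⟩ := μ.nonempty_of_neZero
  have hbdd : BddBelow (Set.range f) :=
    ⟨f x₀ - c, by rintro _ ⟨x, rfl⟩; linarith [(abs_le.1 (hc x₀ x)).2]⟩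
  have hmem : ∀ x, f x ∈ Set.Icc (⨅ y, f y) ((⨅ y, f y) + c) := fun x => by
    have : Nonempty α := ⟨x₀⟩
    have := le_ciInf fun y => sub_le_comm.1 (abs_le.1 (hc x y)).2
    exact ⟨ciInf_le hbdd x, by linarith⟩
  simpa using hasSubgaussianMGF_of_mem_Icc hf.aemeasurable (ae_of_all μ hmem)

theorem hasSubgaussianMGF_prod_sub_integral {α β : Type*} [MeasurableSpace α] [MeasurableSpace β]
    {μ : Measure α} {ν : Measure β} [IsProbabilityMeasure μ] [IsProbabilityMeasure ν]
    {f : α × β → ℝ} {c C : ℝ≥0} (hf : Measurable f)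
    (hfst : ∀ a a' b, |f (a, b) - f (a', b)| ≤ c)
    (hsnd : ∀ a, HasSubgaussianMGF (fun b => f (a, b) - ∫ b', f (a, b') ∂ν) C ν) :
    HasSubgaussianMGF (fun z => f z - ∫ z', f z' ∂μ.prod ν) ((c / 2) ^ 2 + C) (μ.prod ν) := by
  have hsection : ∀ a, Integrable (fun b => f (a, b)) ν := fun a => by
    simpa only [Pi.add_def, sub_add_cancel] using
      (hsnd a).integrable.add (integrable_const (∫ b', f (a, b') ∂ν))
  have hmean_meas : Measurable fun a => ∫ b, f (a, b) ∂ν :=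
    hf.stronglyMeasurable.integral_prod_right'.measurable
  have hmean : ∀ a a', |∫ b, f (a, b) ∂ν - ∫ b, f (a', b) ∂ν| ≤ c := fun a a' => by
    rw [← integral_sub (hsection a) (hsection a')]
    simpa using norm_integral_le_of_norm_le_const (μ := ν)
      (f := fun b => f (a, b) - f (a', b)) (ae_of_all ν fun b => hfst a a' b)
  have hsum := hasSubgaussianMGF_prod_add (Y := fun z => f z - ∫ b, f (z.1, b) ∂ν)
    (hf.sub (hmean_meas.comp measurable_fst))
    (hasSubgaussianMGF_sub_integral_of_abs_sub_le (μ := μ) hmean_meas hmean) hsnd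
  simp only [sub_add_sub_cancel'] at hsum
  have hint : Integrable f (μ.prod ν) := by
    simpa only [Pi.add_def, sub_add_cancel] using
      hsum.integrable.add (integrable_const (∫ a, ∫ b, f (a, b) ∂ν ∂μ))
  rwa [integral_prod f hint]

theorem HasBoundedDifferences.hasSubgaussianMGF_pi_fin : ∀ {n : ℕ} {S : Fin n → Type*}
    [∀ i, MeasurableSpace (S i)] (μ : ∀ i, Measure (S i)) [∀ i, IsProbabilityMeasure (μ i)]
    {F : (∀ i, S i) → ℝ} {c : Fin n → ℝ≥0}, HasBoundedDifferences F c → Measurable F →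
      HasSubgaussianMGF (fun x => F x - ∫ y, F y ∂Measure.pi μ) (∑ i, (c i / 2) ^ 2)
        (Measure.pi μ)
  | 0, S, _, μ, _, F, c, _, _ => by
    have hconst : ∀ x, F x - ∫ y, F y ∂Measure.pi μ = 0 := fun x => by
      simp only [Subsingleton.elim _ x, integral_const, probReal_univ, one_smul, sub_self]
    simp [hconst]
  | n + 1, S, _, μ, _, F, c, hF, hF_meas => by
    let e := MeasurableEquiv.piFinSuccAbove S 0
    have hmeas : Measurable (F ∘ e.symm) := hF_meas.comp e.symm.measurable
    have hfst : ∀ a a' y, |F (e.symm (a, y)) - F (e.symm (a', y))| ≤ c 0 := fun a a' y => by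
      convert hF (e.symm (a', y)) 0 a using 4
      exact (Fin.update_insertNth 0 a' a y).symm
    have hslice : ∀ a, HasBoundedDifferences (fun y => F (e.symm (a, y)))
        fun j => c (Fin.succAbove 0 j) := fun a y j s => by
      convert hF (e.symm (a, y)) (Fin.succAbove 0 j) s using 4
      exact Fin.insertNth_update 0 a j s y
    have hprod := hasSubgaussianMGF_prod_sub_integral (μ := μ 0) hmeas hfst fun a =>
      (hslice a).hasSubgaussianMGF_pi_fin (fun j => μ (Fin.succAbove 0 j))
        (hmeas.comp measurable_prodMk_left)
    rw [← (measurePreserving_piFinSuccAbove μ 0).map_eq] at hprod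
    rw [integral_map e.measurable.aemeasurable hmeas.aestronglyMeasurable] at hprod
    rw [Fin.sum_univ_succAbove _ 0]
    simpa only [Function.comp_def, e.symm_apply_apply] using hprod.of_map e.measurable.aemeasurable

theorem HasBoundedDifferences.hasSubgaussianMGF_of_iIndepFun {Ω ι : Type*} [MeasurableSpace Ω]
    {μ : Measure Ω} [IsProbabilityMeasure μ] [Fintype ι] [DecidableEq ι] {S : ι → Type*}
    [∀ i, MeasurableSpace (S i)] {X : ∀ i, Ω → S i} {F : (∀ i, S i) → ℝ} {c : ι → ℝ≥0}
    (hF : HasBoundedDifferences F c) (hF_meas : Measurable F) (hX : iIndepFun X μ)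
    (hX_meas : ∀ i, Measurable (X i)) :
    HasSubgaussianMGF (fun ω => F (fun i => X i ω) - ∫ ω', F (fun i => X i ω') ∂μ)
      (∑ i, (c i / 2) ^ 2) μ := by
  let σ := (Fintype.equivFin ι).symm
  let e := MeasurableEquiv.piCongrLeft S σ
  have he : ∀ ω, e (fun j => X (σ j) ω) = fun i => X i ω := fun ω =>
    e.apply_symm_apply fun i => X i ω
  have hFe : HasBoundedDifferences (F ∘ e) (c ∘ σ) := fun x j s => by
    have hupdate : e (Function.update x j s) = Function.update (e x) (σ j) s :=
      Function.piCongrLeft'_symm_update S σ.symm x j s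
    simpa only [Function.comp_apply, hupdate] using hF (e x) (σ j) s
  have hprob := fun j => Measure.isProbabilityMeasure_map (μ := μ) (hX_meas (σ j)).aemeasurable
  have hXσ : Measurable fun ω j => X (σ j) ω := measurable_pi_lambda _ fun j => hX_meas (σ j)
  have hpi := hFe.hasSubgaussianMGF_pi_fin (fun j => μ.map (X (σ j))) (hF_meas.comp e.measurable)
  rw [← (iIndepFun_iff_map_fun_eq_pi_map fun j => (hX_meas (σ j)).aemeasurable).1
    (hX.precomp σ.injective)] at hpi
  rw [integral_map hXσ.aemeasurable (hF_meas.comp e.measurable).aestronglyMeasurable] at hpi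
  simpa only [Function.comp_def, he, σ.sum_comp fun i => (c i / 2) ^ 2] using
    hpi.of_map hXσ.aemeasurable

end McDiarmid

section LimitedDependence

variable {Ω ι κ : Type*} [MeasurableSpace Ω] {μ : Measure Ω} [DecidableEq ι] {S : ι → Type*}

theorem hasSubgaussianMGF_mono {X : Ω → ℝ} {c C : ℝ≥0} (hX : HasSubgaussianMGF X c μ)
    (hcC : c ≤ C) : HasSubgaussianMGF X C μ where
  integrable_exp_mul := hX.integrable_exp_mul
  mgf_le t := (hX.mgf_le t).trans <| by gcongr

theorem hasBoundedDifferences_sum_of_dependsOn {τ : Finset κ} {f : κ → (∀ i, S i) → ℝ}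
    {D : κ → Finset ι} (hf : ∀ t x, |f t x| ≤ 1) (hD : ∀ t, DependsOn (f t) (D t)) :
    HasBoundedDifferences (fun x => ∑ t ∈ τ, f t x) fun i => 2 * #{t ∈ τ | i ∈ D t} := by
  intro x i s
  have hterm : ∀ t, |f t (Function.update x i s) - f t x| ≤ if i ∈ D t then 2 else 0 := fun t => by
    split_ifs with hi
    · linarith [abs_sub (f t (Function.update x i s)) (f t x), hf t (Function.update x i s), hf t x]
    · rw [hD t fun j hj => Function.update_of_ne (ne_of_mem_of_not_mem hj hi) s x, sub_self,
        abs_zero]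
  calc |∑ t ∈ τ, f t (Function.update x i s) - ∑ t ∈ τ, f t x|
    _ ≤ ∑ t ∈ τ, |f t (Function.update x i s) - f t x| := by
        rw [← Finset.sum_sub_distrib]
        exact Finset.abs_sum_le_sum_abs _ _
    _ ≤ ∑ t ∈ τ, if i ∈ D t then 2 else 0 := Finset.sum_le_sum fun t _ => hterm t
    _ = ((2 * #{t ∈ τ | i ∈ D t} : ℝ≥0) : ℝ) := by
        rw [← Finset.sum_filter, Finset.sum_const, nsmul_eq_mul]
        push_cast
        ring

theorem hasSubgaussianMGF_sum_of_dependsOn [IsProbabilityMeasure μ] [Finite ι]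
    [∀ i, MeasurableSpace (S i)] {X : ∀ i, Ω → S i} (hX : iIndepFun X μ)
    (hX_meas : ∀ i, Measurable (X i)) {τ : Finset κ} {f : κ → (∀ i, S i) → ℝ} {D : κ → Finset ι}
    {k l : ℕ} (hf_meas : ∀ t, Measurable (f t)) (hf : ∀ t x, |f t x| ≤ 1)
    (hD : ∀ t, DependsOn (f t) (D t)) (hk : ∀ t ∈ τ, #(D t) ≤ k)
    (hl : ∀ i, #{t ∈ τ | i ∈ D t} ≤ l) :
    HasSubgaussianMGF
      (fun ω => ∑ t ∈ τ, f t (fun i => X i ω) - ∫ ω', ∑ t ∈ τ, f t (fun i => X i ω') ∂μ)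
      (k * l * #τ) μ := by
  have := Fintype.ofFinite ι
  have hcount : ∑ i, #{t ∈ τ | i ∈ D t} ^ 2 ≤ k * l * #τ := calc
    _ ≤ ∑ i, l * #{t ∈ τ | i ∈ D t} := Finset.sum_le_sum fun i _ => by
        rw [sq]
        exact Nat.mul_le_mul_right _ (hl i)
    _ = l * ∑ t ∈ τ, #(D t) := by
        have := Finset.sum_card_bipartiteAbove_eq_sum_card_bipartiteBelow
          (s := τ) (t := Finset.univ) fun t i => i ∈ D t
        simp only [Finset.bipartiteAbove, Finset.bipartiteBelow, Finset.filter_univ_mem] at this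
        rw [← Finset.mul_sum, this]
    _ ≤ l * (#τ * k) := Nat.mul_le_mul_left _ (Finset.sum_le_card_nsmul _ _ _ hk)
    _ = k * l * #τ := by ring
  refine hasSubgaussianMGF_mono ((hasBoundedDifferences_sum_of_dependsOn hf hD)
    |>.hasSubgaussianMGF_of_iIndepFun (Finset.measurable_sum τ fun t _ => hf_meas t) hX hX_meas) ?_
  simp only [mul_div_cancel_left₀ _ (two_ne_zero' ℝ≥0)]
  exact_mod_cast hcount

end LimitedDependence

section Matchings

variable {V W : Type*}

/-- A partial matching between `V` and `W`, encoded as its set of matched pairs: no vertex of either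
side occurs in two pairs. -/
structure IsPartialMatching (S : Finset (V × W)) : Prop where
  fst_injOn : Set.InjOn Prod.fst (S : Set (V × W))
  snd_injOn : Set.InjOn Prod.snd (S : Set (V × W))

theorem IsPartialMatching.eq_left {S : Finset (V × W)} (hS : IsPartialMatching S) {a a' : V} {b : W}
    (h : (a, b) ∈ S) (h' : (a', b) ∈ S) : a = a' :=
  congrArg Prod.fst (hS.snd_injOn h h' rfl)

theorem IsPartialMatching.eq_right {S : Finset (V × W)} (hS : IsPartialMatching S) {a : V}
    {b b' : W} (h : (a, b) ∈ S) (h' : (a, b') ∈ S) : b = b' :=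
  congrArg Prod.snd (hS.fst_injOn h h' rfl)

variable [DecidableEq V] [DecidableEq W] {D S T : Finset (V × W)}

theorem card_filter_crossed_mem_le (hD : IsPartialMatching D) :
    #{t ∈ S ×ˢ T | t.1 ≠ t.2 ∧ (t.2.1, t.1.2) ∈ D ∧ (t.1.1, t.2.2) ∈ D} ≤ #(T \ D) := by
  refine Finset.card_le_card_of_injOn Prod.snd ?_ ?_
  · rintro ⟨⟨x₁, x₂⟩, ⟨y₁, y₂⟩⟩ ht
    simp only [Finset.coe_filter, Finset.mem_product, Set.mem_ofPred_eq] at ht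
    obtain ⟨⟨-, hyT⟩, hne, hyx, hxy⟩ := ht
    refine Finset.mem_coe.2 (Finset.mem_sdiff.2 ⟨hyT, fun hyD => hne ?_⟩)
    exact Prod.ext (hD.eq_left hxy hyD) (hD.eq_right hyx hyD)
  · rintro ⟨⟨x₁, x₂⟩, ⟨y₁, y₂⟩⟩ ht ⟨⟨x₁', x₂'⟩, ⟨y₁', y₂'⟩⟩ ht' h
    obtain ⟨rfl, rfl⟩ := Prod.mk.inj h
    simp only [Finset.coe_filter, Set.mem_ofPred_eq] at ht ht'
    obtain ⟨-, -, hyx, hxy⟩ := ht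
    obtain ⟨-, -, hyx', hxy'⟩ := ht'
    rw [hD.eq_left hxy hxy', hD.eq_right hyx hyx']

theorem card_filter_diag_sdiff_le :
    #{t ∈ (D ×ˢ D) \ (S ×ˢ T) | t.1 = t.2} ≤ #(D \ S) + #(D \ T) := by
  refine (Finset.card_le_card_of_injOn Prod.fst (t := (D \ S) ∪ (D \ T)) ?_ ?_).trans
    (Finset.card_union_le _ _)
  · rintro ⟨x, y⟩ ht
    simp only [Finset.coe_filter, Finset.mem_sdiff, Finset.mem_product, Set.mem_ofPred_eq] at ht
    obtain ⟨⟨⟨hx, -⟩, hST⟩, rfl⟩ := ht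
    simp only [Finset.mem_coe, Finset.mem_union, Finset.mem_sdiff]
    tauto
  · rintro ⟨x, y⟩ ht ⟨x', y'⟩ ht' h
    have hxy : x = y := (Finset.mem_filter.1 ht).2
    have hxy' : x' = y' := (Finset.mem_filter.1 ht').2
    have hxx' : x = x' := h
    rw [← hxy, ← hxy', hxx']

theorem card_mul_le_two_mul_card_sdiff_product :
    #D * (#(D \ S) + #(D \ T)) ≤ 2 * #((D ×ˢ D) \ (S ×ˢ T)) := by
  have hfst : (D \ S) ×ˢ D ⊆ (D ×ˢ D) \ (S ×ˢ T) := fun t ht => by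
    simp only [Finset.mem_sdiff, Finset.mem_product] at ht ⊢
    tauto
  have hsnd : D ×ˢ (D \ T) ⊆ (D ×ˢ D) \ (S ×ˢ T) := fun t ht => by
    simp only [Finset.mem_sdiff, Finset.mem_product] at ht ⊢
    tauto
  have := Finset.card_le_card hfst
  have := Finset.card_le_card hsnd
  simp only [Finset.card_product] at *
  linarith

theorem card_symmDiff_eq_two_mul_card_sdiff {α : Type*} [DecidableEq α] {S T : Finset α}
    (h : #S = #T) : #(symmDiff S T) = 2 * #(S \ T) := by
  rw [Finset.symmDiff_def, Finset.card_union_of_disjoint disjoint_sdiff_sdiff,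
    Finset.card_sdiff_comm h, two_mul]

theorem card_sdiff_product_comm (hS : #S = #D) (hT : #T = #D) :
    #((S ×ˢ T) \ (D ×ˢ D)) = #((D ×ˢ D) \ (S ×ˢ T)) :=
  Finset.card_sdiff_comm (by rw [Finset.card_product, Finset.card_product, hS, hT])

variable {w : (V × W) × (V × W) → ℝ} {s ε : ℝ}

theorem sum_sdiff_product_ge (hsε : s + ε ≤ 1) (hdiag : ∀ x, w (x, x) = 0)
    (hcore : ∀ x ∈ D, ∀ y ∈ D, x ≠ y → s + ε ≤ w (x, y)) :
    (s + ε) * #((D ×ˢ D) \ (S ×ˢ T)) - (#(D \ S) + #(D \ T)) ≤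
      ∑ t ∈ (D ×ˢ D) \ (S ×ˢ T), w t := by
  have hterm : ∀ t ∈ (D ×ˢ D) \ (S ×ˢ T), s + ε - (if t.1 = t.2 then 1 else 0) ≤ w t := by
    rintro ⟨x, y⟩ ht
    have hxy := Finset.mem_product.1 (Finset.mem_sdiff.1 ht).1
    split_ifs with h
    · obtain rfl : x = y := h
      linarith [hdiag x]
    · linarith [hcore x hxy.1 y hxy.2 h]
  have hsum := Finset.sum_le_sum hterm
  have hcard : (#{t ∈ (D ×ˢ D) \ (S ×ˢ T) | t.1 = t.2} : ℝ) ≤ #(D \ S) + #(D \ T) :=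
    mod_cast card_filter_diag_sdiff_le
  rw [Finset.sum_sub_distrib, Finset.sum_const, nsmul_eq_mul, Finset.sum_boole] at hsum
  linarith

theorem sum_sdiff_product_le (hD : IsPartialMatching D) (hs : 0 ≤ s) (hw : ∀ t, w t ≤ 1)
    (hdiag : ∀ x, w (x, x) = 0)
    (hlarge : ∀ x y, s < w (x, y) → (x ∈ D ∧ y ∈ D) ∨ ((y.1, x.2) ∈ D ∧ (x.1, y.2) ∈ D)) :
    ∑ t ∈ (S ×ˢ T) \ (D ×ˢ D), w t ≤ s * #((S ×ˢ T) \ (D ×ˢ D)) + #(T \ D) := by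
  have hterm : ∀ t ∈ (S ×ˢ T) \ (D ×ˢ D), w t ≤ s + if s < w t then 1 else 0 := fun t _ => by
    split_ifs with h
    · linarith [hw t]
    · linarith
  have hsub : {t ∈ (S ×ˢ T) \ (D ×ˢ D) | s < w t} ⊆
      {t ∈ S ×ˢ T | t.1 ≠ t.2 ∧ (t.2.1, t.1.2) ∈ D ∧ (t.1.1, t.2.2) ∈ D} := by
    rintro ⟨x, y⟩ ht
    obtain ⟨hST, hDD⟩ := Finset.mem_sdiff.1 (Finset.mem_filter.1 ht).1
    have hlt := (Finset.mem_filter.1 ht).2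
    refine Finset.mem_filter.2 ⟨hST, ?_, ?_⟩
    · rintro (rfl : x = y)
      exact hs.not_gt (hdiag x ▸ hlt)
    · exact (hlarge x y hlt).resolve_left fun h => hDD (Finset.mem_product.2 h)
  have hcard : (#{t ∈ (S ×ˢ T) \ (D ×ˢ D) | s < w t} : ℝ) ≤ #(T \ D) :=
    mod_cast (Finset.card_le_card hsub).trans (card_filter_crossed_mem_le hD)
  have hsum := Finset.sum_le_sum hterm
  rw [Finset.sum_add_distrib, Finset.sum_const, nsmul_eq_mul, Finset.sum_boole] at hsum
  linarith

theorem le_sum_product_sub_sum_product (hD : IsPartialMatching D) (hS : #S = #D) (hT : #T = #D)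
    (hs : 0 ≤ s) (hsε : s + ε ≤ 1) (hw : ∀ t, w t ≤ 1) (hdiag : ∀ x, w (x, x) = 0)
    (hcore : ∀ x ∈ D, ∀ y ∈ D, x ≠ y → s + ε ≤ w (x, y))
    (hlarge : ∀ x y, s < w (x, y) → (x ∈ D ∧ y ∈ D) ∨ ((y.1, x.2) ∈ D ∧ (x.1, y.2) ∈ D)) :
    ε * #((D ×ˢ D) \ (S ×ˢ T)) - 2 * (#(D \ S) + #(D \ T)) ≤
      ∑ t ∈ D ×ˢ D, w t - ∑ t ∈ S ×ˢ T, w t := by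
  have hDD := sum_sdiff_product_ge (S := S) (T := T) hsε hdiag hcore
  have hST := sum_sdiff_product_le (S := S) (T := T) hD hs hw hdiag hlarge
  rw [card_sdiff_product_comm hS hT, Finset.card_sdiff_comm hT] at hST
  rw [← Finset.sum_sdiff_sub_sum_sdiff]
  linarith [Nat.cast_nonneg (α := ℝ) #(D \ S)]

end Matchings

section AlignmentScore

variable {V W : Type*}

theorem card_filter_eq_some_sym2_le_two {κ : Type*} [DecidableEq V] {τ : Finset κ} {g : κ → V × V}
    (hg : Set.InjOn g τ) (o : Option (Sym2 V)) : #{t ∈ τ | o = some s((g t).1, (g t).2)} ≤ 2 := by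
  rcases o with _ | e
  · simp
  induction e using Sym2.ind with | _ a b =>
  refine (Finset.card_le_card_of_injOn g (t := {(a, b), (b, a)}) (fun t ht => ?_)
    (hg.mono (Finset.coe_subset.2 (Finset.filter_subset _ _)))).trans Finset.card_le_two
  have h : s((g t).1, (g t).2) = s(a, b) := (Option.some.inj (Finset.mem_filter.1 ht).2).symm
  rw [Finset.coe_pair, Set.mem_insert_iff, Set.mem_singleton_iff]
  exact Sym2.mk_eq_mk_iff.1 h

theorem IsPartialMatching.injOn_fst_prod {S T : Finset (V × W)} (hS : IsPartialMatching S)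
    (hT : IsPartialMatching T) :
    Set.InjOn (fun t : (V × W) × (V × W) => (t.2.1, t.1.1)) (S ×ˢ T : Finset _) := by
  intro t ht t' ht' h
  have ht := Finset.mem_product.1 ht
  have ht' := Finset.mem_product.1 ht'
  exact Prod.ext (hS.fst_injOn ht.1 ht'.1 (Prod.mk.inj h).2)
    (hT.fst_injOn ht.2 ht'.2 (Prod.mk.inj h).1)

theorem IsPartialMatching.injOn_snd_prod {S T : Finset (V × W)} (hS : IsPartialMatching S)
    (hT : IsPartialMatching T) :
    Set.InjOn (fun t : (V × W) × (V × W) => (t.1.2, t.2.2)) (S ×ˢ T : Finset _) := by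
  intro t ht t' ht' h
  have ht := Finset.mem_product.1 ht
  have ht' := Finset.mem_product.1 ht'
  exact Prod.ext (hS.snd_injOn ht.1 ht'.1 (Prod.mk.inj h).1)
    (hT.snd_injOn ht.2 ht'.2 (Prod.mk.inj h).2)

/-- The summand of `alignmentScore` at a pair of matched pairs of vertices: the product of the signs
of the edge of `G` and of the edge of `H` which they join. -/
noncomputable def alignmentTerm (G : SimpleGraph V) (H : SimpleGraph W)
    (t : (V × W) × (V × W)) : ℝ :=
  signedAdjMatrix G t.2.1 t.1.1 * signedAdjMatrix H t.1.2 t.2.2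

/-- The value of the bilinear form `trace (A P B Qᵀ)`, for the signed adjacency matrices `A` of `G`
and `B` of `H`, at the indicator matrices `P` of `S` and `Q` of `T`. -/
noncomputable def alignmentScore (G : SimpleGraph V) (H : SimpleGraph W)
    (S T : Finset (V × W)) : ℝ :=
  ∑ t ∈ S ×ˢ T, alignmentTerm G H t

theorem signedAdjMatrix_diag (G : SimpleGraph V) (i : V) : signedAdjMatrix G i i = 0 := if_pos rfl

theorem abs_signedAdjMatrix_le_one (G : SimpleGraph V) (i j : V) : |signedAdjMatrix G i j| ≤ 1 := by
  simp only [signedAdjMatrix, Matrix.of_apply]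
  split_ifs <;> simp

theorem abs_alignmentTerm_le_one (G : SimpleGraph V) (H : SimpleGraph W)
    (t : (V × W) × (V × W)) : |alignmentTerm G H t| ≤ 1 := by
  rw [alignmentTerm, abs_mul]
  exact mul_le_one₀ (abs_signedAdjMatrix_le_one G _ _) (abs_nonneg _)
    (abs_signedAdjMatrix_le_one H _ _)

end AlignmentScore

section DecodedGraph

variable {ι V : Type*}

/-- The graph read off from the values `x` of a family of blocks: the block `b` carries the pair of
vertices `edge b`, if any, and this pair is an edge when `x b = 1`. -/
def decodedGraph (edge : ι → Option (Sym2 V)) (x : ι → ℝ) : SimpleGraph V :=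
  .fromEdgeSet {e | ∃ b, edge b = some e ∧ x b = 1}

variable {edge : ι → Option (Sym2 V)}

open Classical in
theorem signedAdjMatrix_decodedGraph (x : ι → ℝ) {i j : V} (hij : i ≠ j) :
    signedAdjMatrix (decodedGraph edge x) i j =
      if ∃ b, edge b = some s(i, j) ∧ x b = 1 then 1 else -1 := by
  simp [signedAdjMatrix, decodedGraph, hij]

theorem dependsOn_signedAdjMatrix_decodedGraph (i j : V) :
    DependsOn (fun x : ι → ℝ => signedAdjMatrix (decodedGraph edge x) i j)
      {b | edge b = some s(i, j)} := by
  intro x y hxy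
  obtain rfl | hij := eq_or_ne i j
  · simp only [signedAdjMatrix_diag]
  classical
  simp only [signedAdjMatrix_decodedGraph _ hij]
  exact if_congr (exists_congr fun b => and_congr_right fun hb => by rw [hxy b hb]) rfl rfl

theorem measurable_signedAdjMatrix_decodedGraph [Countable ι] (i j : V) :
    Measurable fun x : ι → ℝ => signedAdjMatrix (decodedGraph edge x) i j := by
  obtain rfl | hij := eq_or_ne i j
  · simp only [signedAdjMatrix_diag, measurable_const]
  classical
  simp only [signedAdjMatrix_decodedGraph _ hij]
  refine Measurable.ite ?_ measurable_const measurable_const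
  exact measurableSet_setOfPred.2 <| Measurable.exists fun b => Measurable.and measurable_const
    (measurableSet_setOfPred.1 <| measurable_pi_apply b <| measurableSet_singleton 1)

end DecodedGraph

section ScoreConcentration

variable {Ω ι V W : Type*} {firstEdge : ι → Option (Sym2 V)} {secondEdge : ι → Option (Sym2 W)}

theorem measurable_alignmentTerm_decodedGraph [Countable ι] (t : (V × W) × (V × W)) :
    Measurable fun x : ι → ℝ × ℝ => alignmentTerm (decodedGraph firstEdge fun b => (x b).1)
      (decodedGraph secondEdge fun b => (x b).2) t := by
  refine Measurable.mul ?_ ?_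
  · exact (measurable_signedAdjMatrix_decodedGraph t.2.1 t.1.1).comp (by fun_prop)
  · exact (measurable_signedAdjMatrix_decodedGraph t.1.2 t.2.2).comp (by fun_prop)

variable [DecidableEq V] [DecidableEq W] {D S T : Finset (V × W)}

/-- The blocks which carry one of the two edges of an `alignmentTerm`. -/
def termBlocks [Fintype ι] (firstEdge : ι → Option (Sym2 V)) (secondEdge : ι → Option (Sym2 W))
    (t : (V × W) × (V × W)) : Finset ι :=
  {b | firstEdge b = some s(t.2.1, t.1.1) ∨ secondEdge b = some s(t.1.2, t.2.2)}

theorem card_filter_edge_eq_le_one [Fintype ι] {edge : ι → Option (Sym2 V)}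
    (hedge : Set.InjOn edge {b | (edge b).isSome}) (e : Sym2 V) :
    #{b | edge b = some e} ≤ 1 := by
  refine Finset.card_le_one.2 fun b hb b' hb' => ?_
  have hb := (Finset.mem_filter.1 hb).2
  have hb' := (Finset.mem_filter.1 hb').2
  exact hedge (by simp [hb]) (by simp [hb']) (hb.trans hb'.symm)

theorem card_termBlocks_le_two [Fintype ι]
    (hfirst : Set.InjOn firstEdge {b | (firstEdge b).isSome})
    (hsecond : Set.InjOn secondEdge {b | (secondEdge b).isSome}) (t : (V × W) × (V × W)) :
    #(termBlocks firstEdge secondEdge t) ≤ 2 := by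
  classical
  rw [termBlocks, Finset.filter_or]
  exact (Finset.card_union_le _ _).trans (add_le_add (card_filter_edge_eq_le_one hfirst _)
    (card_filter_edge_eq_le_one hsecond _))

theorem card_filter_mem_termBlocks_le_four [Fintype ι] [DecidableEq ι] (hS : IsPartialMatching S)
    (hT : IsPartialMatching T) (b : ι) :
    #{t ∈ S ×ˢ T | b ∈ termBlocks firstEdge secondEdge t} ≤ 4 := by
  simp only [termBlocks, Finset.mem_filter_univ]
  rw [Finset.filter_or]
  exact (Finset.card_union_le _ _).trans (add_le_add
    (card_filter_eq_some_sym2_le_two (hS.injOn_fst_prod hT) (firstEdge b))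
    (card_filter_eq_some_sym2_le_two (hS.injOn_snd_prod hT) (secondEdge b)))

theorem dependsOn_alignmentTerm [Fintype ι] (t : (V × W) × (V × W)) :
    DependsOn (fun x : ι → ℝ × ℝ => alignmentTerm (decodedGraph firstEdge fun b => (x b).1)
      (decodedGraph secondEdge fun b => (x b).2) t) (termBlocks firstEdge secondEdge t) := by
  intro x y hxy
  have hfirst := dependsOn_signedAdjMatrix_decodedGraph (edge := firstEdge) t.2.1 t.1.1
    (x := fun b => (x b).1) (y := fun b => (y b).1) fun b hb =>
      congrArg Prod.fst (hxy b (by simpa [termBlocks] using Or.inl hb))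
  have hsecond := dependsOn_signedAdjMatrix_decodedGraph (edge := secondEdge) t.1.2 t.2.2
    (x := fun b => (x b).2) (y := fun b => (y b).2) fun b hb =>
      congrArg Prod.snd (hxy b (by simpa [termBlocks] using Or.inr hb))
  exact congrArg₂ (· * ·) hfirst hsecond

theorem alignmentScore_sub_eq_sum_symmDiff (G : SimpleGraph V) (H : SimpleGraph W) :
    alignmentScore G H S T - alignmentScore G H D D =
      ∑ t ∈ symmDiff (D ×ˢ D) (S ×ˢ T), (if t ∈ D ×ˢ D then -1 else 1) * alignmentTerm G H t := by
  rw [alignmentScore, alignmentScore, ← Finset.sum_sdiff_sub_sum_sdiff, Finset.symmDiff_def,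
    Finset.sum_union disjoint_sdiff_sdiff, add_comm, sub_eq_add_neg, ← Finset.sum_neg_distrib]
  congr 1
  · refine Finset.sum_congr rfl fun t ht => ?_
    rw [if_neg (Finset.mem_sdiff.1 ht).2, one_mul]
  · refine Finset.sum_congr rfl fun t ht => ?_
    rw [if_pos (Finset.mem_sdiff.1 ht).1, neg_one_mul]

theorem card_filter_symmDiff_mem_termBlocks_le_eight [Fintype ι] [DecidableEq ι]
    (hD : IsPartialMatching D) (hS : IsPartialMatching S) (hT : IsPartialMatching T) (b : ι) :
    #{t ∈ symmDiff (D ×ˢ D) (S ×ˢ T) | b ∈ termBlocks firstEdge secondEdge t} ≤ 8 := by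
  have hsub := Finset.filter_subset_filter (fun t => b ∈ termBlocks firstEdge secondEdge t)
    (show symmDiff (D ×ˢ D) (S ×ˢ T) ⊆ D ×ˢ D ∪ S ×ˢ T from symmDiff_le_sup)
  rw [Finset.filter_union] at hsub
  exact (Finset.card_le_card hsub).trans <| (Finset.card_union_le _ _).trans <|
    add_le_add (card_filter_mem_termBlocks_le_four hD hD b)
      (card_filter_mem_termBlocks_le_four hS hT b)

theorem hasSubgaussianMGF_alignmentScore_sub [Finite ι] [MeasurableSpace Ω]
    {μ : Measure Ω} [IsProbabilityMeasure μ] {X : ι → Ω → ℝ × ℝ} (hX : iIndepFun X μ)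
    (hX_meas : ∀ b, Measurable (X b)) {G : Ω → SimpleGraph V} {H : Ω → SimpleGraph W}
    (hG : ∀ ω, G ω = decodedGraph firstEdge fun b => (X b ω).1)
    (hH : ∀ ω, H ω = decodedGraph secondEdge fun b => (X b ω).2)
    (hfirst : Set.InjOn firstEdge {b | (firstEdge b).isSome})
    (hsecond : Set.InjOn secondEdge {b | (secondEdge b).isSome})
    (hD : IsPartialMatching D) (hS : IsPartialMatching S) (hT : IsPartialMatching T) :
    HasSubgaussianMGF (fun ω =>
      alignmentScore (G ω) (H ω) S T - alignmentScore (G ω) (H ω) D D -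
        ∫ ω', (alignmentScore (G ω') (H ω') S T - alignmentScore (G ω') (H ω') D D) ∂μ)
      (16 * #(symmDiff (D ×ˢ D) (S ×ˢ T))) μ := by
  classical
  have := Fintype.ofFinite ι
  simp only [alignmentScore_sub_eq_sum_symmDiff, hG, hH]
  have h := hasSubgaussianMGF_sum_of_dependsOn hX hX_meas (τ := symmDiff (D ×ˢ D) (S ×ˢ T))
    (f := fun t x => (if t ∈ D ×ˢ D then -1 else 1) *
      alignmentTerm (decodedGraph firstEdge fun b => (x b).1)
        (decodedGraph secondEdge fun b => (x b).2) t)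
    (k := 2) (l := 8) (fun t => (measurable_alignmentTerm_decodedGraph t).const_mul _)
    (fun t x => ?_) (fun t x y hxy => congrArg _ (dependsOn_alignmentTerm t hxy))
    (fun t _ => card_termBlocks_le_two hfirst hsecond t)
    (card_filter_symmDiff_mem_termBlocks_le_eight hD hS hT)
  · have hk : ((2 : ℕ) : ℝ≥0) * (8 : ℕ) = 16 := by norm_num
    rwa [hk] at h
  · rw [abs_mul]
    exact mul_le_one₀ (by split_ifs <;> simp) (abs_nonneg _) (abs_alignmentTerm_le_one _ _ t)

end ScoreConcentration

section IndicatorMatrix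

variable {V W : Type*} [DecidableEq V] [DecidableEq W]

/-- The `0`-`1` matrix whose entries equal to `1` are those at the positions in `S`. -/
noncomputable def indicatorMatrix (S : Finset (V × W)) : Matrix V W ℝ :=
  Matrix.of fun i j => if (i, j) ∈ S then 1 else 0

theorem exists_indicatorMatrix_eq [Finite V] [Finite W] {P : Matrix V W ℝ}
    (hP : ∀ i j, P i j = 0 ∨ P i j = 1) : ∃ S, indicatorMatrix S = P := by
  refine ⟨(Set.toFinite {x | P x.1 x.2 = 1}).toFinset, Matrix.ext fun i j => ?_⟩
  rcases hP i j with h | h <;> simp [indicatorMatrix, h]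

variable [Fintype V] [Fintype W]

theorem sum_mul_indicatorMatrix (f : V → W → ℝ) (S : Finset (V × W)) :
    ∑ i, ∑ j, f i j * indicatorMatrix S i j = ∑ x ∈ S, f x.1 x.2 := by
  rw [← Fintype.sum_prod_type' fun i j => f i j * indicatorMatrix S i j]
  simp only [indicatorMatrix, Matrix.of_apply, Prod.mk.eta, mul_ite, mul_one, mul_zero]
  rw [Finset.sum_ite_mem, Finset.univ_inter]

theorem isPartialMatching_iff_sum_indicatorMatrix_le_one {S : Finset (V × W)} :
    IsPartialMatching S ↔
      (∀ i, ∑ j, indicatorMatrix S i j ≤ 1) ∧ ∀ j, ∑ i, indicatorMatrix S i j ≤ 1 := by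
  simp only [indicatorMatrix, Matrix.of_apply, Finset.sum_boole, Nat.cast_le_one,
    Finset.card_le_one, Finset.mem_filter_univ]
  refine ⟨fun hS => ⟨fun i j hj j' hj' => hS.eq_right hj hj',
    fun j i hi i' hi' => hS.eq_left hi hi'⟩, fun ⟨hrow, hcol⟩ => ⟨?_, ?_⟩⟩
  · rintro ⟨i, j⟩ hj ⟨i', j'⟩ hj' (rfl : i = i')
    rw [hrow i j hj j' hj']
  · rintro ⟨i, j⟩ hi ⟨i', j'⟩ hi' (rfl : j = j')
    rw [hcol j i hi i' hi']

theorem trace_mul_indicatorMatrix (G : SimpleGraph V) (H : SimpleGraph W) (S T : Finset (V × W)) :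
    Matrix.trace (signedAdjMatrix G * indicatorMatrix S * signedAdjMatrix H *
      (indicatorMatrix T).transpose) = alignmentScore G H S T := by
  have hentry : ∀ i l, (signedAdjMatrix G * indicatorMatrix S * signedAdjMatrix H) i l =
      ∑ x ∈ S, signedAdjMatrix G i x.1 * signedAdjMatrix H x.2 l := fun i l => by
    rw [← sum_mul_indicatorMatrix fun j k => signedAdjMatrix G i j * signedAdjMatrix H k l]
    simp only [Matrix.mul_apply, Finset.sum_mul]
    rw [Finset.sum_comm]
    exact Finset.sum_congr rfl fun j _ => Finset.sum_congr rfl fun k _ => mul_right_comm _ _ _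
  simp only [Matrix.trace, Matrix.diag_apply, Matrix.transpose_apply,
    Matrix.mul_apply (N := (indicatorMatrix T).transpose), hentry]
  rw [sum_mul_indicatorMatrix, alignmentScore, Finset.sum_product_right]
  rfl

end IndicatorMatrix

section CoreMatching

variable {m n K : ℕ}

theorem indicatorMatrix_mem_matchingMatrices_iff {S : Finset (Fin m × Fin n)} :
    indicatorMatrix S ∈ matchingMatrices m n K ↔ IsPartialMatching S ∧ #S = K := by
  rw [isPartialMatching_iff_sum_indicatorMatrix_le_one, matchingMatrices, Set.mem_ofPred_eq,
    and_assoc]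
  have hsum : ∑ i, ∑ j, indicatorMatrix S i j = #S := by
    simpa using sum_mul_indicatorMatrix (fun _ _ => 1) S
  rw [hsum, Nat.cast_inj]
  refine and_iff_right fun i j => ?_
  rw [indicatorMatrix, Matrix.of_apply]
  split_ifs <;> simp

/-- The matching of the cores of `[m]` and `[n]`, which pairs every `i < K` with itself. -/
def coreMatching (m n K : ℕ) : Finset (Fin m × Fin n) :=
  {x | (x.1 : ℕ) = x.2 ∧ (x.1 : ℕ) < K}

theorem mem_coreMatching {x : Fin m × Fin n} :
    x ∈ coreMatching m n K ↔ (x.1 : ℕ) = x.2 ∧ (x.1 : ℕ) < K :=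
  Finset.mem_filter_univ x

theorem indicatorMatrix_coreMatching :
    indicatorMatrix (coreMatching m n K) = coreMatrix m n K := by
  ext i j
  simp only [indicatorMatrix, coreMatrix, Matrix.of_apply, mem_coreMatching]

theorem isPartialMatching_coreMatching : IsPartialMatching (coreMatching m n K) where
  fst_injOn _ hx _ hy h := Prod.ext h <| Fin.ext <|
    (mem_coreMatching.1 hx).1.symm.trans <| (congrArg Fin.val h).trans (mem_coreMatching.1 hy).1
  snd_injOn _ hx _ hy h := Prod.ext (Fin.ext <| (mem_coreMatching.1 hx).1.trans <|
    (congrArg Fin.val h).trans (mem_coreMatching.1 hy).1.symm) h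

theorem card_coreMatching (hm : K ≤ m) (hn : K ≤ n) : #(coreMatching m n K) = K := by
  refine (Finset.card_nbij (s := .univ) (fun k : Fin K => (Fin.castLE hm k, Fin.castLE hn k))
    ?_ ?_ ?_).symm.trans (Finset.card_fin K)
  · exact fun k _ => mem_coreMatching.2 ⟨rfl, k.2⟩
  · exact fun k _ l _ h => Fin.castLE_injective hm (Prod.mk.inj h).1
  · intro x hx
    obtain ⟨hval, hlt⟩ := mem_coreMatching.1 hx
    exact ⟨⟨x.1, hlt⟩, Finset.mem_coe.2 (Finset.mem_univ _), Prod.ext rfl (Fin.ext hval)⟩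

end CoreMatching

section ArgMax

/-- The core matching, taken twice, has a larger alignment score than every other pair of partial
matchings of the same size: the statement of the theorem with matchings in place of matrices. -/
def CoreIsUniquelyOptimal {m n : ℕ} (G : SimpleGraph (Fin m)) (H : SimpleGraph (Fin n)) (K : ℕ) :
    Prop :=
  ∀ S T, IsPartialMatching S → IsPartialMatching T → #S = K → #T = K →
    (S, T) ≠ (coreMatching m n K, coreMatching m n K) →
    alignmentScore G H S T < alignmentScore G H (coreMatching m n K) (coreMatching m n K)

theorem argMaxOn_eq_singleton {α : Type*} {f : α → ℝ} {s : Set α} {a : α} (ha : a ∈ s)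
    (hlt : ∀ b ∈ s, b ≠ a → f b < f a) : argMaxOn f s = {a} := by
  refine Set.eq_singleton_iff_unique_mem.2 ⟨⟨ha, fun b hb => ?_⟩, fun b hb => ?_⟩
  · obtain rfl | hba := eq_or_ne b a
    exacts [le_rfl, (hlt b hb hba).le]
  · by_contra hba
    exact (hlt b hb.1 hba).not_ge (hb.2 a ha)

theorem argMaxOn_trace_eq_singleton_coreMatrix {m n K : ℕ} (hm : K ≤ m) (hn : K ≤ n)
    {G : SimpleGraph (Fin m)} {H : SimpleGraph (Fin n)}
    (hopt : CoreIsUniquelyOptimal G H K) :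
    argMaxOn (fun PQ : Matrix (Fin m) (Fin n) ℝ × Matrix (Fin m) (Fin n) ℝ =>
        Matrix.trace (signedAdjMatrix G * PQ.1 * signedAdjMatrix H * PQ.2.transpose))
      (matchingMatrices m n K ×ˢ matchingMatrices m n K) =
        {(coreMatrix m n K, coreMatrix m n K)} := by
  have hcore : indicatorMatrix (coreMatching m n K) ∈ matchingMatrices m n K :=
    indicatorMatrix_mem_matchingMatrices_iff.2
      ⟨isPartialMatching_coreMatching, card_coreMatching hm hn⟩
  rw [← indicatorMatrix_coreMatching]
  refine argMaxOn_eq_singleton ⟨hcore, hcore⟩ ?_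
  rintro ⟨P, Q⟩ ⟨hP, hQ⟩ hne
  obtain ⟨S, rfl⟩ := exists_indicatorMatrix_eq hP.1
  obtain ⟨T, rfl⟩ := exists_indicatorMatrix_eq hQ.1
  obtain ⟨hS, hSK⟩ := indicatorMatrix_mem_matchingMatrices_iff.1 hP
  obtain ⟨hT, hTK⟩ := indicatorMatrix_mem_matchingMatrices_iff.1 hQ
  rw [trace_mul_indicatorMatrix, trace_mul_indicatorMatrix]
  exact hopt S T hS hT hSK hTK fun h => hne <| by rw [(Prod.mk.inj h).1, (Prod.mk.inj h).2]

end ArgMax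

section AdjacencyIndicator

variable {Ω V : Type*} {G : Ω → SimpleGraph V}

theorem adjInd_eq_one_iff {i j : V} {ω : Ω} : adjInd G i j ω = 1 ↔ (G ω).Adj i j :=
  Set.indicator_eq_one_iff_mem ℝ

theorem adjInd_comm (i j : V) : adjInd G i j = adjInd G j i := by
  simp only [adjInd, SimpleGraph.adj_comm]

theorem signedAdjMatrix_comm (G : SimpleGraph V) (i j : V) :
    signedAdjMatrix G i j = signedAdjMatrix G j i := by
  classical exact if_congr eq_comm rfl (if_congr (G.adj_comm i j) rfl rfl)

theorem signedAdjMatrix_eq_two_mul_adjInd_sub_one {i j : V} (hij : i ≠ j) (ω : Ω) :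
    signedAdjMatrix (G ω) i j = 2 * adjInd G i j ω - 1 := by
  by_cases h : (G ω).Adj i j <;> simp [signedAdjMatrix, adjInd, Set.indicator, hij, h]
  norm_num

variable [MeasurableSpace Ω] {μ : Measure Ω}

theorem measurableSet_adj (i j : V) : MeasurableSet {G : SimpleGraph V | G.Adj i j} := by
  measurability

theorem measurable_adjInd (hG : Measurable G) (i j : V) : Measurable (adjInd G i j) :=
  measurable_const.indicator (hG (measurableSet_adj i j))

theorem integral_adjInd (hG : Measurable G) (i j : V) :
    ∫ ω, adjInd G i j ω ∂μ = μ.real {ω | (G ω).Adj i j} :=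
  integral_indicator_one (hG (measurableSet_adj i j))

theorem measurable_signedAdjMatrix (hG : Measurable G) (i j : V) :
    Measurable fun ω => signedAdjMatrix (G ω) i j := by
  obtain rfl | hij := eq_or_ne i j
  · simp only [signedAdjMatrix_diag, measurable_const]
  · simp only [signedAdjMatrix_eq_two_mul_adjInd_sub_one hij]
    exact ((measurable_adjInd hG i j).const_mul 2).sub_const 1

theorem memLp_adjInd [IsFiniteMeasure μ] (hG : Measurable G) (i j : V) :
    MemLp (adjInd G i j) 2 μ := by
  refine .of_bound (measurable_adjInd hG i j).aestronglyMeasurable 1 (ae_of_all μ fun ω => ?_)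
  by_cases h : (G ω).Adj i j <;> simp [adjInd, Set.indicator, h]

theorem integrable_adjInd [IsFiniteMeasure μ] (hG : Measurable G) (i j : V) :
    Integrable (adjInd G i j) μ :=
  (memLp_adjInd hG i j).integrable one_le_two

variable [IsProbabilityMeasure μ]

theorem variance_adjInd (hG : Measurable G) (i j : V) :
    variance (adjInd G i j) μ =
      μ.real {ω | (G ω).Adj i j} * (1 - μ.real {ω | (G ω).Adj i j}) := by
  have hsq : adjInd G i j ^ 2 = adjInd G i j := by
    ext ω
    by_cases h : (G ω).Adj i j <;> simp [adjInd, Set.indicator, h]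
  rw [variance_eq_sub (memLp_adjInd hG i j), hsq, integral_adjInd hG]
  ring

theorem integral_signedAdjMatrix (hG : Measurable G) {i j : V} (hij : i ≠ j) :
    ∫ ω, signedAdjMatrix (G ω) i j ∂μ = 2 * μ.real {ω | (G ω).Adj i j} - 1 := by
  simp only [signedAdjMatrix_eq_two_mul_adjInd_sub_one hij]
  rw [integral_sub ((integrable_adjInd hG i j).const_mul 2) (integrable_const 1),
    integral_const_mul, integral_adjInd hG, integral_const, probReal_univ, one_smul]

theorem abs_integral_signedAdjMatrix_le [LinearOrder V] {q : ℝ} (hG : Measurable G)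
    (hq : ∀ i j, i < j → μ.real {ω | (G ω).Adj i j} ∈ Set.Icc q (1 - q)) {i j : V} (hij : i ≠ j) :
    |∫ ω, signedAdjMatrix (G ω) i j ∂μ| ≤ 1 - 2 * q := by
  wlog hlt : i < j generalizing i j
  · simpa only [signedAdjMatrix_comm] using this hij.symm (hij.lt_or_gt.resolve_left hlt)
  obtain ⟨hl, hu⟩ := hq i j hlt
  rw [integral_signedAdjMatrix hG hij, abs_le]
  constructor <;> linarith

variable {W : Type*} {H : Ω → SimpleGraph W}

theorem integral_mul_signedAdjMatrix (hG : Measurable G) (hH : Measurable H) {i j : V} {k l : W}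
    (hij : i ≠ j) (hkl : k ≠ l) :
    ∫ ω, signedAdjMatrix (G ω) i j * signedAdjMatrix (H ω) k l ∂μ =
      4 * covariance (adjInd G i j) (adjInd H k l) μ +
        (2 * μ.real {ω | (G ω).Adj i j} - 1) * (2 * μ.real {ω | (H ω).Adj k l} - 1) := by
  have hGi := integrable_adjInd (μ := μ) hG i j
  have hHi := integrable_adjInd (μ := μ) hH k l
  have hprod := (memLp_adjInd (μ := μ) hG i j).integrable_mul (memLp_adjInd (μ := μ) hH k l)
  have hexpand : ∀ ω, signedAdjMatrix (G ω) i j * signedAdjMatrix (H ω) k l =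
      4 * (adjInd G i j * adjInd H k l) ω - 2 * adjInd G i j ω - 2 * adjInd H k l ω + 1 := by
    intro ω
    rw [signedAdjMatrix_eq_two_mul_adjInd_sub_one hij,
      signedAdjMatrix_eq_two_mul_adjInd_sub_one hkl, Pi.mul_apply]
    ring
  simp only [hexpand]
  rw [covariance_eq_sub (memLp_adjInd hG i j) (memLp_adjInd hH k l),
    integral_add (by fun_prop) (integrable_const 1), integral_sub (by fun_prop) (by fun_prop),
    integral_sub (by fun_prop) (by fun_prop), integral_const_mul, integral_const_mul,
    integral_const_mul, integral_adjInd hG, integral_adjInd hH, integral_const, probReal_univ,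
    one_smul]
  ring

theorem pearsonCorr_le_integral_mul_signedAdjMatrix (hG : Measurable G) (hH : Measurable H)
    {i j : V} {k l : W} (hij : i ≠ j) (hkl : k ≠ l)
    (hp : μ.real {ω | (G ω).Adj i j} = μ.real {ω | (H ω).Adj k l})
    (hpos : 0 < pearsonCorr (adjInd G i j) (adjInd H k l) μ)
    (hle : pearsonCorr (adjInd G i j) (adjInd H k l) μ ≤ 1) :
    pearsonCorr (adjInd G i j) (adjInd H k l) μ ≤
      ∫ ω, signedAdjMatrix (G ω) i j * signedAdjMatrix (H ω) k l ∂μ := by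
  set p := μ.real {ω | (G ω).Adj i j} with hp_def
  have hcorr : pearsonCorr (adjInd G i j) (adjInd H k l) μ =
      covariance (adjInd G i j) (adjInd H k l) μ / (p * (1 - p)) := by
    rw [pearsonCorr, variance_adjInd hG, variance_adjInd hH, ← hp, ← hp_def, Real.mul_self_sqrt]
    exact mul_nonneg measureReal_nonneg (sub_nonneg.2 measureReal_le_one)
  have hvar : p * (1 - p) ≠ 0 := fun h => by simp [hcorr, h] at hpos
  rw [integral_mul_signedAdjMatrix hG hH hij hkl, ← hp, ← hp_def, ← (eq_div_iff hvar).1 hcorr]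
  nlinarith [mul_nonneg (sub_nonneg.2 hle) (sq_nonneg (2 * p - 1))]

end AdjacencyIndicator

section BlockEdges

variable {Ω : Type*} {m n K : ℕ} {hm : K ≤ m} {hn : K ≤ n}

/-- The pair of vertices of the first graph whose adjacency belongs to the block, if any. -/
def firstEdge (hm : K ≤ m) : AdjBlock m n K → Option (Sym2 (Fin m))
  | .inl e => some s(Fin.castLE hm e.1.1, Fin.castLE hm e.1.2)
  | .inr (.inl e) => some s(e.1.1, e.1.2)
  | .inr (.inr _) => none

/-- The pair of vertices of the second graph whose adjacency belongs to the block, if any. -/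
def secondEdge (hn : K ≤ n) : AdjBlock m n K → Option (Sym2 (Fin n))
  | .inl e => some s(Fin.castLE hn e.1.1, Fin.castLE hn e.1.2)
  | .inr (.inl _) => none
  | .inr (.inr e) => some s(e.1.1, e.1.2)

theorem eq_and_eq_of_sym2_eq_of_lt {V : Type*} [Preorder V] {a b c d : V} (hab : a < b)
    (hcd : c < d) (h : s(a, b) = s(c, d)) : a = c ∧ b = d := by
  rcases Sym2.eq_iff.1 h with h | ⟨rfl, rfl⟩
  exacts [h, absurd hcd hab.asymm]

theorem injOn_firstEdge :
    Set.InjOn (firstEdge hm) {b : AdjBlock m n K | (firstEdge hm b).isSome} := by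
  rintro (⟨e, he⟩ | ⟨e, he, heK⟩ | e) hb (⟨f, hf⟩ | ⟨f, hf, hfK⟩ | f) hb' h
  case inr.inr.inl | inr.inr.inr.inl | inr.inr.inr.inr => cases hb
  case inl.inr.inr | inr.inl.inr.inr => cases hb'
  all_goals
    have hval := eq_and_eq_of_sym2_eq_of_lt (by exact he) (by exact hf) (Option.some.inj h)
    simp only [Fin.ext_iff, Fin.val_castLE] at hval
    simp only [Sum.inl.injEq, Sum.inr.injEq, reduceCtorEq, Subtype.mk.injEq, Prod.ext_iff,
      Fin.ext_iff]
    omega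

theorem injOn_secondEdge :
    Set.InjOn (secondEdge hn) {b : AdjBlock m n K | (secondEdge hn b).isSome} := by
  rintro (⟨e, he⟩ | e | ⟨e, he, heK⟩) hb (⟨f, hf⟩ | f | ⟨f, hf, hfK⟩) hb' h
  case inr.inl.inl | inr.inl.inr.inl | inr.inl.inr.inr => cases hb
  case inl.inr.inl | inr.inr.inr.inl => cases hb'
  all_goals
    have hval := eq_and_eq_of_sym2_eq_of_lt (by exact he) (by exact hf) (Option.some.inj h)
    simp only [Fin.ext_iff, Fin.val_castLE] at hval
    simp only [Sum.inl.injEq, Sum.inr.injEq, reduceCtorEq, Subtype.mk.injEq, Prod.ext_iff,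
      Fin.ext_iff]
    omega

theorem exists_firstEdge_eq (hm : K ≤ m) {i j : Fin m} (hij : i ≠ j) :
    ∃ b : AdjBlock m n K, firstEdge hm b = some s(i, j) := by
  wlog hlt : i < j generalizing i j
  · rw [Sym2.eq_swap]
    exact this hij.symm (hij.lt_or_gt.resolve_left hlt)
  by_cases hj : (j : ℕ) < K
  · exact ⟨.inl ⟨(⟨i, (Fin.lt_def.1 hlt).trans hj⟩, ⟨j, hj⟩), hlt⟩, rfl⟩
  · exact ⟨.inr (.inl ⟨(i, j), hlt, not_lt.1 hj⟩), rfl⟩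

theorem exists_secondEdge_eq (hn : K ≤ n) {i j : Fin n} (hij : i ≠ j) :
    ∃ b : AdjBlock m n K, secondEdge hn b = some s(i, j) := by
  wlog hlt : i < j generalizing i j
  · rw [Sym2.eq_swap]
    exact this hij.symm (hij.lt_or_gt.resolve_left hlt)
  by_cases hj : (j : ℕ) < K
  · exact ⟨.inl ⟨(⟨i, (Fin.lt_def.1 hlt).trans hj⟩, ⟨j, hj⟩), hlt⟩, rfl⟩
  · exact ⟨.inr (.inr ⟨(i, j), hlt, not_lt.1 hj⟩), rfl⟩

theorem mem_coreMatching_of_firstEdge_eq_of_secondEdge_eq {b : AdjBlock m n K} {i j : Fin m}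
    {k l : Fin n} (hfirst : firstEdge hm b = some s(i, j))
    (hsecond : secondEdge hn b = some s(k, l)) :
    ((i, k) ∈ coreMatching m n K ∧ (j, l) ∈ coreMatching m n K) ∨
      ((i, l) ∈ coreMatching m n K ∧ (j, k) ∈ coreMatching m n K) := by
  rcases b with ⟨⟨a, c⟩, h⟩ | e | e
  · have hcore : ∀ x : Fin K, (Fin.castLE hm x, Fin.castLE hn x) ∈ coreMatching m n K := fun x =>
      mem_coreMatching.2 ⟨rfl, x.2⟩
    rcases Sym2.eq_iff.1 (Option.some.inj hfirst) with ⟨rfl, rfl⟩ | ⟨rfl, rfl⟩ <;>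
      rcases Sym2.eq_iff.1 (Option.some.inj hsecond) with ⟨rfl, rfl⟩ | ⟨rfl, rfl⟩ <;>
      simp only [hcore, and_self, true_or, or_true]
  · simp [secondEdge] at hsecond
  · simp [firstEdge] at hfirst

variable {G : Ω → SimpleGraph (Fin m)} {H : Ω → SimpleGraph (Fin n)}

theorem adjBlockVar_fst_eq_adjInd {b : AdjBlock m n K} {i j : Fin m}
    (hb : firstEdge hm b = some s(i, j)) (ω : Ω) :
    (adjBlockVar hm hn G H b ω).1 = adjInd G i j ω := by
  rcases b with e | e | e
  · rcases Sym2.eq_iff.1 (Option.some.inj hb) with ⟨rfl, rfl⟩ | ⟨rfl, rfl⟩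
    exacts [rfl, congrFun (adjInd_comm _ _) ω]
  · rcases Sym2.eq_iff.1 (Option.some.inj hb) with ⟨rfl, rfl⟩ | ⟨rfl, rfl⟩
    exacts [rfl, congrFun (adjInd_comm _ _) ω]
  · simp [firstEdge] at hb

theorem adjBlockVar_snd_eq_adjInd {b : AdjBlock m n K} {i j : Fin n}
    (hb : secondEdge hn b = some s(i, j)) (ω : Ω) :
    (adjBlockVar hm hn G H b ω).2 = adjInd H i j ω := by
  rcases b with e | e | e
  · rcases Sym2.eq_iff.1 (Option.some.inj hb) with ⟨rfl, rfl⟩ | ⟨rfl, rfl⟩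
    exacts [rfl, congrFun (adjInd_comm _ _) ω]
  · simp [secondEdge] at hb
  · rcases Sym2.eq_iff.1 (Option.some.inj hb) with ⟨rfl, rfl⟩ | ⟨rfl, rfl⟩
    exacts [rfl, congrFun (adjInd_comm _ _) ω]

theorem decodedGraph_firstEdge_adjBlockVar (ω : Ω) :
    decodedGraph (firstEdge hm) (fun b => (adjBlockVar hm hn G H b ω).1) = G ω := by
  ext i j
  rw [decodedGraph, SimpleGraph.fromEdgeSet_adj, Set.mem_ofPred_eq]
  refine ⟨fun ⟨⟨b, hb, hx⟩, _⟩ => ?_, fun h => ?_⟩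
  · rwa [adjBlockVar_fst_eq_adjInd hb, adjInd_eq_one_iff] at hx
  · obtain ⟨b, hb⟩ := exists_firstEdge_eq (n := n) hm h.ne
    exact ⟨⟨b, hb, by rwa [adjBlockVar_fst_eq_adjInd hb, adjInd_eq_one_iff]⟩, h.ne⟩

theorem decodedGraph_secondEdge_adjBlockVar (ω : Ω) :
    decodedGraph (secondEdge hn) (fun b => (adjBlockVar hm hn G H b ω).2) = H ω := by
  ext i j
  rw [decodedGraph, SimpleGraph.fromEdgeSet_adj, Set.mem_ofPred_eq]
  refine ⟨fun ⟨⟨b, hb, hx⟩, _⟩ => ?_, fun h => ?_⟩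
  · rwa [adjBlockVar_snd_eq_adjInd hb, adjInd_eq_one_iff] at hx
  · obtain ⟨b, hb⟩ := exists_secondEdge_eq (m := m) hn h.ne
    exact ⟨⟨b, hb, by rwa [adjBlockVar_snd_eq_adjInd hb, adjInd_eq_one_iff]⟩, h.ne⟩

theorem measurable_adjBlockVar [MeasurableSpace Ω] (hG : Measurable G) (hH : Measurable H)
    (b : AdjBlock m n K) : Measurable (adjBlockVar hm hn G H b) := by
  rcases b with e | e | e
  · exact (measurable_adjInd hG _ _).prodMk (measurable_adjInd hH _ _)
  · exact (measurable_adjInd hG _ _).prodMk measurable_const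
  · exact measurable_const.prodMk (measurable_adjInd hH _ _)

theorem integral_mul_signedAdjMatrix_of_iIndepFun [MeasurableSpace Ω] {μ : Measure Ω}
    (hindep : iIndepFun (adjBlockVar hm hn G H) μ) (hG : Measurable G) (hH : Measurable H)
    {b c : AdjBlock m n K} (hbc : b ≠ c) {i j : Fin m} {k l : Fin n} (hij : i ≠ j) (hkl : k ≠ l)
    (hb : firstEdge hm b = some s(i, j)) (hc : secondEdge hn c = some s(k, l)) :
    ∫ ω, signedAdjMatrix (G ω) i j * signedAdjMatrix (H ω) k l ∂μ =
      (∫ ω, signedAdjMatrix (G ω) i j ∂μ) * ∫ ω, signedAdjMatrix (H ω) k l ∂μ := by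
  have hpair : IndepFun (fun ω => signedAdjMatrix (G ω) i j)
      (fun ω => signedAdjMatrix (H ω) k l) μ := by
    have h := (hindep.indepFun hbc).comp (φ := fun x => 2 * x.1 - 1) (ψ := fun x => 2 * x.2 - 1)
      (by fun_prop) (by fun_prop)
    simpa only [Function.comp_def, adjBlockVar_fst_eq_adjInd hb, adjBlockVar_snd_eq_adjInd hc,
      ← signedAdjMatrix_eq_two_mul_adjInd_sub_one hij,
      ← signedAdjMatrix_eq_two_mul_adjInd_sub_one hkl] using h
  exact hpair.integral_fun_mul_eq_mul_integral
    (measurable_signedAdjMatrix hG i j).aestronglyMeasurable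
    (measurable_signedAdjMatrix hH k l).aestronglyMeasurable

end BlockEdges

section ModelParameters

/-- The hypotheses of the theorem on a single model instance: all edge probabilities lie in
`[q, 1 - q]` and all core correlations are at least `(1 - 2 q)²`. -/
structure ModelParams.IsAdmissible (M : ModelParams) (q : ℝ) : Prop where
  p_mem_Icc : ∀ i j, i < j → j < max M.m M.n → M.p i j ∈ Set.Icc q (1 - q)
  sq_le_rho : ∀ i j, i < j → j < M.K → (1 - 2 * q) ^ 2 ≤ M.rho i j

/-- The matching of the core of the first graph with the core of the second graph. -/
abbrev ModelParams.core (M : ModelParams) : Finset (Fin M.m × Fin M.n) :=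
  coreMatching M.m M.n M.K

variable {M : ModelParams} {q : ℝ}

theorem ModelParams.card_core : #M.core = M.K :=
  card_coreMatching M.K_le_m M.K_le_n

theorem ModelParams.IsAdmissible.sq_add_eps_le_rho (hM : M.IsAdmissible q) {i j : ℕ} (hij : i < j)
    (hj : j < M.K) : (1 - 2 * q) ^ 2 + M.eps q ≤ M.rho i j := by
  rw [← le_sub_iff_add_le', ModelParams.eps]
  refine csInf_le ⟨0, ?_⟩ ⟨i, j, hij, hj, rfl⟩
  rintro _ ⟨k, l, hkl, hl, rfl⟩
  exact sub_nonneg.2 (hM.sq_le_rho k l hkl hl)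

theorem ModelParams.IsAdmissible.eps_nonneg (hM : M.IsAdmissible q) : 0 ≤ M.eps q := by
  refine Real.sInf_nonneg ?_
  rintro _ ⟨i, j, hij, hj, rfl⟩
  exact sub_nonneg.2 (hM.sq_le_rho i j hij hj)

theorem ModelParams.one_lt_K_of_eps_ne_zero (h : M.eps q ≠ 0) : 1 < M.K := by
  by_contra! hK
  refine h ?_
  have hempty : {x : ℝ | ∃ i j : ℕ, i < j ∧ j < M.K ∧ x = M.rho i j - (1 - 2 * q) ^ 2} = ∅ := by
    refine Set.eq_empty_of_forall_notMem ?_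
    rintro _ ⟨i, j, hij, hj, -⟩
    omega
  rw [ModelParams.eps, hempty, Real.sInf_empty]

theorem ModelParams.IsAdmissible.sq_add_eps_le_one (hM : M.IsAdmissible q) (heps : M.eps q ≠ 0) :
    (1 - 2 * q) ^ 2 + M.eps q ≤ 1 :=
  have hK := M.one_lt_K_of_eps_ne_zero heps
  (hM.sq_add_eps_le_rho zero_lt_one hK).trans (M.rho_mem 0 1 zero_lt_one hK).2

end ModelParameters

section ExpectedScore

variable {Ω : Type*} [MeasurableSpace Ω] {μ : Measure Ω}

section Integrability

variable {V W : Type*} {G : Ω → SimpleGraph V} {H : Ω → SimpleGraph W}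

theorem alignmentTerm_swap (G : SimpleGraph V) (H : SimpleGraph W) (t : (V × W) × (V × W)) :
    alignmentTerm G H t.swap = alignmentTerm G H t :=
  congrArg₂ (· * ·) (signedAdjMatrix_comm G _ _) (signedAdjMatrix_comm H _ _)

theorem alignmentTerm_diag (G : SimpleGraph V) (H : SimpleGraph W) (x : V × W) :
    alignmentTerm G H (x, x) = 0 :=
  mul_eq_zero_of_left (signedAdjMatrix_diag G x.1) _

theorem integrable_alignmentTerm [IsFiniteMeasure μ] (hG : Measurable G) (hH : Measurable H)
    (t : (V × W) × (V × W)) : Integrable (fun ω => alignmentTerm (G ω) (H ω) t) μ :=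
  .of_bound ((measurable_signedAdjMatrix hG _ _).mul
    (measurable_signedAdjMatrix hH _ _)).aestronglyMeasurable 1
    (ae_of_all μ fun ω => abs_alignmentTerm_le_one (G ω) (H ω) t)

theorem integral_alignmentTerm_le_one [IsProbabilityMeasure μ] (hG : Measurable G)
    (hH : Measurable H) (t : (V × W) × (V × W)) : ∫ ω, alignmentTerm (G ω) (H ω) t ∂μ ≤ 1 := by
  simpa using integral_mono (integrable_alignmentTerm (μ := μ) hG hH t) (integrable_const 1)
    fun ω => (abs_le.1 (abs_alignmentTerm_le_one (G ω) (H ω) t)).2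

theorem integrable_alignmentScore [IsFiniteMeasure μ] (hG : Measurable G) (hH : Measurable H)
    (S T : Finset (V × W)) : Integrable (fun ω => alignmentScore (G ω) (H ω) S T) μ :=
  integrable_finsetSum _ fun t _ => integrable_alignmentTerm hG hH t

theorem integral_alignmentScore [IsFiniteMeasure μ] (hG : Measurable G) (hH : Measurable H)
    (S T : Finset (V × W)) :
    ∫ ω, alignmentScore (G ω) (H ω) S T ∂μ =
      ∑ t ∈ S ×ˢ T, ∫ ω, alignmentTerm (G ω) (H ω) t ∂μ :=
  integral_finsetSum _ fun t _ => integrable_alignmentTerm hG hH t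

end Integrability

namespace IsCorrelatedBernoulli

variable [IsProbabilityMeasure μ] {M : ModelParams} {q : ℝ} {G : Ω → SimpleGraph (Fin M.m)}
  {H : Ω → SimpleGraph (Fin M.n)}

theorem rho_le_integral_mul_signedAdjMatrix (hM : IsCorrelatedBernoulli μ M G H) {i j : Fin M.K}
    (hij : i < j) (hpos : 0 < M.rho i j) :
    M.rho i j ≤ ∫ ω, signedAdjMatrix (G ω) (i.castLE M.K_le_m) (j.castLE M.K_le_m) *
      signedAdjMatrix (H ω) (i.castLE M.K_le_n) (j.castLE M.K_le_n) ∂μ := by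
  have hprob := (hM.prob_G (i.castLE M.K_le_m) (j.castLE M.K_le_m) hij).trans
    (hM.prob_H (i.castLE M.K_le_n) (j.castLE M.K_le_n) hij).symm
  rw [← hM.corr i j hij] at hpos ⊢
  refine pearsonCorr_le_integral_mul_signedAdjMatrix hM.measurable_G hM.measurable_H
    (Fin.castLE_injective M.K_le_m |>.ne hij.ne) (Fin.castLE_injective M.K_le_n |>.ne hij.ne)
    hprob hpos ?_
  rw [hM.corr i j hij]
  exact (M.rho_mem i j hij j.2).2

theorem sq_add_eps_le_integral_alignmentTerm (hM : IsCorrelatedBernoulli μ M G H)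
    (hq : M.IsAdmissible q) (heps : 0 < M.eps q) {x y : Fin M.m × Fin M.n}
    (hx : x ∈ M.core) (hy : y ∈ M.core) (hxy : x ≠ y) :
    (1 - 2 * q) ^ 2 + M.eps q ≤ ∫ ω, alignmentTerm (G ω) (H ω) (x, y) ∂μ := by
  wlog hlt : y.1 < x.1 generalizing x y
  · have hne : x.1 ≠ y.1 := fun h => hxy (isPartialMatching_coreMatching.fst_injOn hx hy h)
    simpa only [← alignmentTerm_swap _ _ (x, y), Prod.swap_prod_mk] using
      this hy hx hxy.symm (hne.lt_or_gt.resolve_right hlt)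
  obtain ⟨hx_eq, hxK⟩ := mem_coreMatching.1 hx
  obtain ⟨hy_eq, hyK⟩ := mem_coreMatching.1 hy
  have hrho := hq.sq_add_eps_le_rho hlt hxK
  refine (hrho.trans (hM.rho_le_integral_mul_signedAdjMatrix (i := ⟨y.1, hyK⟩) (j := ⟨x.1, hxK⟩) hlt
    (by linarith [sq_nonneg (1 - 2 * q)]))).trans_eq ?_
  have hx2 : x.2 = Fin.castLE M.K_le_n ⟨x.1, hxK⟩ := Fin.ext hx_eq.symm
  have hy2 : y.2 = Fin.castLE M.K_le_n ⟨y.1, hyK⟩ := Fin.ext hy_eq.symm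
  simp only [alignmentTerm, hx2, hy2, signedAdjMatrix_comm (H _) (Fin.castLE _ ⟨x.1, hxK⟩)]
  rfl

theorem abs_integral_signedAdjMatrix_fst_le (hM : IsCorrelatedBernoulli μ M G H)
    (hq : M.IsAdmissible q) {i j : Fin M.m} (hij : i ≠ j) :
    |∫ ω, signedAdjMatrix (G ω) i j ∂μ| ≤ 1 - 2 * q :=
  abs_integral_signedAdjMatrix_le hM.measurable_G (fun a b hab => hM.prob_G a b hab ▸
    hq.p_mem_Icc a b hab (b.2.trans_le (le_max_left _ _))) hij

theorem abs_integral_signedAdjMatrix_snd_le (hM : IsCorrelatedBernoulli μ M G H)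
    (hq : M.IsAdmissible q) {k l : Fin M.n} (hkl : k ≠ l) :
    |∫ ω, signedAdjMatrix (H ω) k l ∂μ| ≤ 1 - 2 * q :=
  abs_integral_signedAdjMatrix_le hM.measurable_H (fun a b hab => hM.prob_H a b hab ▸
    hq.p_mem_Icc a b hab (b.2.trans_le (le_max_right _ _))) hkl

theorem mem_coreMatching_of_sq_lt_integral_alignmentTerm (hM : IsCorrelatedBernoulli μ M G H)
    (hq : M.IsAdmissible q) {x y : Fin M.m × Fin M.n}
    (hlt : (1 - 2 * q) ^ 2 < ∫ ω, alignmentTerm (G ω) (H ω) (x, y) ∂μ) :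
    (x ∈ M.core ∧ y ∈ M.core) ∨
      ((y.1, x.2) ∈ M.core ∧ (x.1, y.2) ∈ M.core) := by
  simp only [alignmentTerm] at hlt
  have hfst : y.1 ≠ x.1 := fun h => by
    simp only [h, signedAdjMatrix_diag, zero_mul, integral_zero] at hlt
    exact hlt.not_ge (sq_nonneg _)
  have hsnd : x.2 ≠ y.2 := fun h => by
    simp only [h, signedAdjMatrix_diag, mul_zero, integral_zero] at hlt
    exact hlt.not_ge (sq_nonneg _)
  obtain ⟨b, hb⟩ := exists_firstEdge_eq (n := M.n) M.K_le_m hfst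
  obtain ⟨c, hc⟩ := exists_secondEdge_eq (m := M.m) M.K_le_n hsnd
  obtain rfl | hbc := eq_or_ne b c
  · exact (mem_coreMatching_of_firstEdge_eq_of_secondEdge_eq hb hc).symm.imp_left And.symm
  refine absurd hlt (not_lt.2 ?_)
  rw [integral_mul_signedAdjMatrix_of_iIndepFun hM.indep hM.measurable_G hM.measurable_H hbc hfst
    hsnd hb hc, sq]
  have hG := hM.abs_integral_signedAdjMatrix_fst_le hq hfst
  have hH := hM.abs_integral_signedAdjMatrix_snd_le hq hsnd
  calc _ ≤ |∫ ω, signedAdjMatrix (G ω) y.1 x.1 ∂μ| * |∫ ω, signedAdjMatrix (H ω) x.2 y.2 ∂μ| :=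
        (le_abs_self _).trans_eq (abs_mul _ _)
    _ ≤ (1 - 2 * q) * (1 - 2 * q) :=
        mul_le_mul hG hH (abs_nonneg _) ((abs_nonneg _).trans hG)

theorem integral_alignmentScore_sub_le (hM : IsCorrelatedBernoulli μ M G H)
    (hq : M.IsAdmissible q) (heps : 0 < M.eps q) {S T : Finset (Fin M.m × Fin M.n)}
    (hS : #S = M.K) (hT : #T = M.K) :
    ∫ ω, (alignmentScore (G ω) (H ω) S T - alignmentScore (G ω) (H ω) M.core M.core) ∂μ ≤
      2 * (#(M.core \ S) + #(M.core \ T)) -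
        M.eps q * #((M.core ×ˢ M.core) \ (S ×ˢ T)) := by
  have hG := hM.measurable_G
  have hH := hM.measurable_H
  rw [integral_sub (integrable_alignmentScore hG hH _ _) (integrable_alignmentScore hG hH _ _),
    integral_alignmentScore hG hH, integral_alignmentScore hG hH]
  have hgap := le_sum_product_sub_sum_product isPartialMatching_coreMatching
    (hS.trans M.card_core.symm) (hT.trans M.card_core.symm)
    (w := fun t => ∫ ω, alignmentTerm (G ω) (H ω) t ∂μ) (sq_nonneg (1 - 2 * q))
    (hq.sq_add_eps_le_one heps.ne') (integral_alignmentTerm_le_one hG hH)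
    (fun x => by simp only [alignmentTerm_diag, integral_zero])
    (fun x hx y hy => hM.sq_add_eps_le_integral_alignmentTerm hq heps hx hy)
    (fun x y => hM.mem_coreMatching_of_sq_lt_integral_alignmentTerm hq)
  linarith

theorem hasSubgaussianMGF_alignmentScore_sub_core (hM : IsCorrelatedBernoulli μ M G H)
    {S T : Finset (Fin M.m × Fin M.n)} (hS : IsPartialMatching S) (hT : IsPartialMatching T) :
    HasSubgaussianMGF (fun ω =>
      alignmentScore (G ω) (H ω) S T - alignmentScore (G ω) (H ω) M.core M.core -
        ∫ ω', (alignmentScore (G ω') (H ω') S T - alignmentScore (G ω') (H ω') M.core M.core) ∂μ)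
      (16 * #(symmDiff (M.core ×ˢ M.core) (S ×ˢ T))) μ :=
  hasSubgaussianMGF_alignmentScore_sub hM.indep
    (measurable_adjBlockVar hM.measurable_G hM.measurable_H)
    (fun ω => (decodedGraph_firstEdge_adjBlockVar ω).symm)
    (fun ω => (decodedGraph_secondEdge_adjBlockVar ω).symm)
    injOn_firstEdge injOn_secondEdge isPartialMatching_coreMatching hS hT

theorem measureReal_alignmentScore_core_le_le_exp (hM : IsCorrelatedBernoulli μ M G H)
    (hq : M.IsAdmissible q) (heps : 8 ≤ M.eps q * M.K) {S T : Finset (Fin M.m × Fin M.n)}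
    (hS : IsPartialMatching S) (hT : IsPartialMatching T) (hSK : #S = M.K) (hTK : #T = M.K) :
    μ.real {ω | alignmentScore (G ω) (H ω) M.core M.core ≤ alignmentScore (G ω) (H ω) S T} ≤
      Real.exp (-(M.eps q ^ 2 * #((M.core ×ˢ M.core) \ (S ×ˢ T)) / 256)) := by
  set N := #((M.core ×ˢ M.core) \ (S ×ˢ T)) with hN
  have heps0 : 0 < M.eps q := pos_of_mul_pos_left (by linarith) M.K.cast_nonneg
  have hcard : (M.K : ℝ) * (#(M.core \ S) + #(M.core \ T)) ≤ 2 * N := by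
    exact_mod_cast M.card_core ▸ card_mul_le_two_mul_card_sdiff_product (D := M.core)
  have hmean := hM.integral_alignmentScore_sub_le hq heps0 hSK hTK
  rw [← hN] at hmean
  have hhalf : 2 * ((#(M.core \ S) : ℝ) + #(M.core \ T)) ≤ M.eps q * N / 2 := by
    nlinarith [mul_le_mul_of_nonneg_left hcard heps0.le]
  have hsymm : #(symmDiff (M.core ×ˢ M.core) (S ×ˢ T)) = 2 * N := by
    refine card_symmDiff_eq_two_mul_card_sdiff ?_
    rw [Finset.card_product, Finset.card_product, hSK, hTK, M.card_core]
  have htail := (hM.hasSubgaussianMGF_alignmentScore_sub_core hS hT).measure_ge_le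
    (ε := M.eps q * N / 2) (by positivity)
  refine (measureReal_mono fun ω hω => ?_).trans (htail.trans_eq ?_)
  · have hω : alignmentScore (G ω) (H ω) M.core M.core ≤ alignmentScore (G ω) (H ω) S T := hω
    rw [Set.mem_ofPred_eq]
    linarith
  · rw [hsymm]
    push_cast
    rcases eq_or_ne N 0 with h | h
    · simp [h]
    · congr 1
      field_simp
      norm_num

theorem measureReal_alignmentScore_core_le_le_pow (hM : IsCorrelatedBernoulli μ M G H)
    (hq : M.IsAdmissible q) (heps : 8 ≤ M.eps q * M.K) {S T : Finset (Fin M.m × Fin M.n)}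
    (hS : IsPartialMatching S) (hT : IsPartialMatching T) (hSK : #S = M.K) (hTK : #T = M.K) :
    μ.real {ω | alignmentScore (G ω) (H ω) M.core M.core ≤ alignmentScore (G ω) (H ω) S T} ≤
      Real.exp (-(M.eps q ^ 2 * M.K / 1024)) ^
        (#(symmDiff M.core S) + #(symmDiff M.core T)) := by
  refine (hM.measureReal_alignmentScore_core_le_le_exp hq heps hS hT hSK hTK).trans ?_
  have hcard : (M.K : ℝ) * (#(M.core \ S) + #(M.core \ T)) ≤
      2 * #((M.core ×ˢ M.core) \ (S ×ˢ T)) := by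
    exact_mod_cast M.card_core ▸ card_mul_le_two_mul_card_sdiff_product (D := M.core)
  rw [← Real.exp_nat_mul, Real.exp_le_exp,
    card_symmDiff_eq_two_mul_card_sdiff (M.card_core.trans hSK.symm),
    card_symmDiff_eq_two_mul_card_sdiff (M.card_core.trans hTK.symm)]
  push_cast
  linarith [mul_le_mul_of_nonneg_left hcard (sq_nonneg (M.eps q))]

end IsCorrelatedBernoulli

end ExpectedScore

section UnionBound

theorem sum_pow_card_symmDiff {κ : Type*} [Fintype κ] [DecidableEq κ] (D : Finset κ) (y : ℝ) :
    ∑ S, y ^ #(symmDiff D S) = (1 + y) ^ Fintype.card κ := by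
  rw [(symmDiff_right_involutive D).bijective.sum_comp fun S : Finset κ => y ^ #S, add_comm]
  simpa only [one_pow, mul_one] using Fintype.sum_pow_mul_eq_add_pow κ y 1

theorem sum_erase_pow_card_symmDiff_add {κ : Type*} [Fintype κ] [DecidableEq κ] (D : Finset κ)
    (y : ℝ) : ∑ ST ∈ Finset.univ.erase (D, D), y ^ (#(symmDiff D ST.1) + #(symmDiff D ST.2)) =
      (1 + y) ^ (2 * Fintype.card κ) - 1 := by
  rw [Finset.sum_erase_eq_sub (Finset.mem_univ _), Fintype.sum_prod_type]
  simp only [pow_add, ← Finset.mul_sum, ← Finset.sum_mul, sum_pow_card_symmDiff, symmDiff_self,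
    Finset.bot_eq_empty, Finset.card_empty, pow_zero, mul_one, two_mul]

theorem one_add_pow_sub_one_le {N L : ℕ} (hN : 2 ≤ N) (hL : L ≤ 2 * N ^ 2) {y : ℝ} (hy0 : 0 ≤ y)
    (hy : y ≤ ((N : ℝ) ^ 4)⁻¹) : (1 + y) ^ L - 1 ≤ 4 * ((N : ℝ) ^ 2)⁻¹ := by
  have hN2 : (2 : ℝ) ≤ N := by exact_mod_cast hN
  have hLy : L * y ≤ 2 * ((N : ℝ) ^ 2)⁻¹ := by
    calc L * y ≤ (2 * (N : ℝ) ^ 2) * ((N : ℝ) ^ 4)⁻¹ :=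
          mul_le_mul (by exact_mod_cast hL) hy hy0 (by positivity)
      _ = 2 * ((N : ℝ) ^ 2)⁻¹ := by field_simp
  have hLy0 : 0 ≤ L * y := by positivity
  have hLy1 : L * y ≤ 1 := hLy.trans <| by
    rw [← div_eq_mul_inv, div_le_one (by positivity)]
    nlinarith
  have hpow : (1 + y) ^ L ≤ Real.exp (L * y) := by
    rw [Real.exp_nat_mul]
    exact pow_le_pow_left₀ (by positivity) (by linarith [Real.add_one_le_exp y]) L
  have hexp := Real.abs_exp_sub_one_le (abs_le.2 ⟨by linarith, hLy1⟩)
  rw [abs_of_nonneg hLy0] at hexp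
  linarith [le_abs_self (Real.exp (L * y) - 1)]

variable {Ω : Type*} [MeasurableSpace Ω] {μ : Measure Ω} [IsProbabilityMeasure μ]
  {M : ModelParams} {q : ℝ} {G : Ω → SimpleGraph (Fin M.m)} {H : Ω → SimpleGraph (Fin M.n)}

theorem IsCorrelatedBernoulli.measureReal_not_coreIsUniquelyOptimal_le
    (hM : IsCorrelatedBernoulli μ M G H) (hq : M.IsAdmissible q) (heps : 8 ≤ M.eps q * M.K) :
    μ.real {ω | ¬ CoreIsUniquelyOptimal (G ω) (H ω) M.K} ≤
      (1 + Real.exp (-(M.eps q ^ 2 * M.K / 1024))) ^ (2 * (M.m * M.n)) - 1 := by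
  let beats (ST : Finset (Fin M.m × Fin M.n) × Finset (Fin M.m × Fin M.n)) : Set Ω :=
    {ω | (IsPartialMatching ST.1 ∧ IsPartialMatching ST.2 ∧ #ST.1 = M.K ∧ #ST.2 = M.K) ∧
      alignmentScore (G ω) (H ω) M.core M.core ≤ alignmentScore (G ω) (H ω) ST.1 ST.2}
  have hbeats : ∀ ST, μ.real (beats ST) ≤ Real.exp (-(M.eps q ^ 2 * M.K / 1024)) ^
      (#(symmDiff M.core ST.1) + #(symmDiff M.core ST.2)) := by
    intro ST
    by_cases hST : IsPartialMatching ST.1 ∧ IsPartialMatching ST.2 ∧ #ST.1 = M.K ∧ #ST.2 = M.K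
    · obtain ⟨hS, hT, hSK, hTK⟩ := hST
      exact (measureReal_mono fun ω hω => hω.2).trans
        (hM.measureReal_alignmentScore_core_le_le_pow hq heps hS hT hSK hTK)
    · have hempty : beats ST = ∅ := Set.eq_empty_of_forall_notMem fun ω hω => hST hω.1
      rw [hempty, measureReal_empty]
      positivity
  have hsub : {ω | ¬ CoreIsUniquelyOptimal (G ω) (H ω) M.K} ⊆
      ⋃ ST ∈ Finset.univ.erase (M.core, M.core), beats ST := by
    intro ω hω
    simp only [CoreIsUniquelyOptimal, Set.mem_ofPred_eq, not_forall, not_lt] at hω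
    obtain ⟨S, T, hS, hT, hSK, hTK, hne, hle⟩ := hω
    exact Set.mem_biUnion (Finset.mem_erase.2 ⟨hne, Finset.mem_univ (S, T)⟩)
      ⟨⟨hS, hT, hSK, hTK⟩, hle⟩
  calc _ ≤ ∑ ST ∈ Finset.univ.erase (M.core, M.core), μ.real (beats ST) :=
        (measureReal_mono hsub (measure_ne_top μ _)).trans (measureReal_biUnion_finset_le _ _)
    _ ≤ _ := Finset.sum_le_sum fun ST _ => hbeats ST
    _ = _ := by
        rw [sum_erase_pow_card_symmDiff_add, Fintype.card_prod, Fintype.card_fin, Fintype.card_fin]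

theorem IsCorrelatedBernoulli.measureReal_not_coreIsUniquelyOptimal_le_inv_sq
    (hM : IsCorrelatedBernoulli μ M G H) (hq : M.IsAdmissible q) {N : ℕ} (hN : 2 ≤ N)
    (hmn : max M.m M.n = N) (heps : 4096 ≤ M.eps q ^ 2 * M.K / Real.log N) :
    μ.real {ω | ¬ CoreIsUniquelyOptimal (G ω) (H ω) M.K} ≤ 4 * ((N : ℝ) ^ 2)⁻¹ := by
  have hlog : 1 / 2 < Real.log N := by
    linarith [Real.log_two_gt_d9, Real.log_le_log zero_lt_two (Nat.ofNat_le_cast.2 hN)]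
  rw [le_div_iff₀ (by linarith)] at heps
  have hne : M.eps q ≠ 0 := fun h => by norm_num [h] at heps; linarith
  have heps0 := hq.eps_nonneg
  have heps1 : M.eps q ≤ 1 := by
    linarith [hq.sq_add_eps_le_one hne, sq_nonneg (1 - 2 * q)]
  have hlarge : 8 ≤ M.eps q * M.K := by
    have : M.eps q ^ 2 * M.K ≤ M.eps q * M.K := by gcongr; nlinarith
    linarith
  refine (hM.measureReal_not_coreIsUniquelyOptimal_le hq hlarge).trans
    (one_add_pow_sub_one_le hN ?_ (Real.exp_pos _).le ?_)
  · rw [sq]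
    gcongr <;> simp [← hmn]
  · rw [← Real.le_log_iff_exp_le (by positivity), Real.log_inv, Real.log_pow]
    push_cast
    linarith

end UnionBound

theorem ae_eventually_of_summable_measureReal_not {Ω : Type*} [MeasurableSpace Ω] {μ : Measure Ω}
    [IsFiniteMeasure μ] {p : ℕ → Ω → Prop} {f : ℕ → ℝ} (hf : Summable f)
    (hp : ∀ᶠ N in atTop, μ.real {ω | ¬ p N ω} ≤ f N) : ∀ᵐ ω ∂μ, ∀ᶠ N in atTop, p N ω := by
  obtain ⟨N₀, hN₀⟩ := eventually_atTop.1 hp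
  have hsum : ∑' N, μ {ω | ¬ p (N + N₀) ω} ≠ ⊤ := by
    refine ne_top_of_le_ne_top ((summable_nat_add_iff N₀).2 hf).tsum_ofReal_ne_top
      (ENNReal.tsum_le_tsum fun N => ?_)
    rw [← ofReal_measureReal]
    exact ENNReal.ofReal_le_ofReal (hN₀ _ (Nat.le_add_left _ _))
  filter_upwards [ae_eventually_notMem hsum] with ω hω
  rw [← map_add_atTop_eq_nat N₀]
  exact hω.mono fun N => not_not.1

theorem mainTheorem2_general {Ω : Type*} [MeasurableSpace Ω] (μ : Measure Ω)
    [IsProbabilityMeasure μ] (M : ℕ → ModelParams)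
    (G : (N : ℕ) → Ω → SimpleGraph (Fin (M N).m))
    (H : (N : ℕ) → Ω → SimpleGraph (Fin (M N).n))
    (hGH : ∀ N, 1 ≤ N → IsCorrelatedBernoulli μ (M N) (G N) (H N))
    (hN : ∀ N, 1 ≤ N → max (M N).m (M N).n = N) (q : ℕ → ℝ)
    (hp : ∀ N, 1 ≤ N → ∀ i j, i < j → j < N → (M N).p i j ∈ Set.Icc (q N) (1 - q N))
    (hrho : ∀ N, 1 ≤ N → ∀ i j, i < j → j < (M N).K → (1 - 2 * q N) ^ 2 ≤ (M N).rho i j)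
    (heps : ∀ᶠ N : ℕ in atTop, 4096 ≤ (M N).eps (q N) ^ 2 * (M N).K / Real.log N) :
    ∀ᵐ ω ∂μ, ∀ᶠ N : ℕ in atTop,
      argMaxOn
        (fun PQ : Matrix (Fin (M N).m) (Fin (M N).n) ℝ × Matrix (Fin (M N).m) (Fin (M N).n) ℝ =>
          Matrix.trace (signedAdjMatrix (G N ω) * PQ.1 * signedAdjMatrix (H N ω) *
            PQ.2.transpose))
        (matchingMatrices (M N).m (M N).n (M N).K ×ˢ matchingMatrices (M N).m (M N).n (M N).K) =
      {(coreMatrix (M N).m (M N).n (M N).K, coreMatrix (M N).m (M N).n (M N).K)} := by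
  have hsummable : Summable fun N : ℕ => 4 * ((N : ℝ) ^ 2)⁻¹ :=
    (Real.summable_nat_pow_inv.2 one_lt_two).mul_left 4
  have hbound : ∀ᶠ N in atTop,
      μ.real {ω | ¬ CoreIsUniquelyOptimal (G N ω) (H N ω) (M N).K} ≤ 4 * ((N : ℝ) ^ 2)⁻¹ := by
    filter_upwards [heps, eventually_ge_atTop 2] with N hlarge hN2
    have hN1 : 1 ≤ N := one_le_two.trans hN2
    have hadm : (M N).IsAdmissible (q N) :=
      ⟨fun i j hij hj => hp N hN1 i j hij (hj.trans_eq (hN N hN1)), hrho N hN1⟩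
    exact (hGH N hN1).measureReal_not_coreIsUniquelyOptimal_le_inv_sq hadm hN2 (hN N hN1) hlarge
  filter_upwards [ae_eventually_of_summable_measureReal_not hsummable hbound] with ω hω
  exact hω.mono fun N => argMaxOn_trace_eq_singleton_coreMatrix (M N).K_le_m (M N).K_le_n

theorem mainTheorem2 {Ω : Type*} [MeasurableSpace Ω] (μ : Measure Ω) [IsProbabilityMeasure μ]
    (M : ℕ → ModelParams)
    (G : (N : ℕ) → Ω → SimpleGraph (Fin (M N).m))
    (H : (N : ℕ) → Ω → SimpleGraph (Fin (M N).n))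
    (hGH : ∀ N, 1 ≤ N → IsCorrelatedBernoulli μ (M N) (G N) (H N))
    (hN : ∀ N, 1 ≤ N → max (M N).m (M N).n = N)
    (q : ℝ) (hq0 : 0 < q) (hq1 : q < 1 / 2)
    (hp : ∀ N, 1 ≤ N → ∀ i j, i < j → j < N → (M N).p i j ∈ Set.Icc q (1 - q))
    (hrho : ∀ N, 1 ≤ N → ∀ i j, i < j → j < (M N).K → (1 - 2 * q) ^ 2 < (M N).rho i j)
    (heps : Tendsto (fun N : ℕ => ((M N).eps q) ^ 2 * ((M N).K : ℝ) / Real.log N) atTop atTop) :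
    ∀ᵐ ω ∂μ, ∀ᶠ N : ℕ in atTop,
      argMaxOn
        (fun PQ : Matrix (Fin (M N).m) (Fin (M N).n) ℝ × Matrix (Fin (M N).m) (Fin (M N).n) ℝ =>
          Matrix.trace (signedAdjMatrix (G N ω) * PQ.1 * signedAdjMatrix (H N ω) *
            PQ.2.transpose))
        (matchingMatrices (M N).m (M N).n (M N).K ×ˢ matchingMatrices (M N).m (M N).n (M N).K) =
      {(coreMatrix (M N).m (M N).n (M N).K, coreMatrix (M N).m (M N).n (M N).K)} :=
  mainTheorem2_general μ M G H hGH hN (fun _ => q) hp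
    (fun N hN1 i j hij hj => (hrho N hN1 i j hij hj).le) (heps.eventually_ge_atTop 4096)
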